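/- **Setting.** Let $d\ge 1$, let $\mathcal X\subset\mathbb R^d$ be measurable, let $(X,Y)$ be a random pair with $X\in\mathcal X$ a.s. and $Y\in\mathbb R$, and let $F(\cdot\,|\,x)$ be the distribution function of a fixed version of the conditional law of $Y$ given $X=x$. Let $(X^j,Y^j)_{j\ge1}$ be i.i.d. copies of $(X,Y)$ and $\mathcal D_n=(X^j,Y^j)_{1\le j\le n}$. Let $\Theta_1,\Theta_2,\dots$ be i.i.d. random elements, independent of $(X^j,Y^j)_{j\ge 1}$. For every $n$, each $\Theta_\ell=(\Theta_\ell^1,\Theta_\ell^2)$ provides * a bootstrap draw: $n$ indices drawn uniformly with replacement from $\{1,\dots,n\}$; $B_j(\Theta_\ell)$ is the number of times that $j$ is drawn, and the bootstrap sample is $\mathcal D_n^\star(\Theta_\ell)$; * for every possible tree node, a set of $\mathrm{max\_features}_n\in\{1,\dots,d\}$ split directions, uniformly distributed among the subsets of $\{1,\dots,d\}$ of that size. For each $n$ and $\ell$ a binary tree is grown with root node $\mathcal X$, as a function of $(\Theta_\ell,\mathcal D_n)$. A node $A$ is either a leaf (the stopping rule is arbitrary) or is cut into $A\cap\{u_i<z\}$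 and $A\cap\{u_i\ge z\}$, where $(i,z)$ minimizes the CART criterion (the sum over the two child nodes of the squared deviations of the responses of the points of $\mathcal D_n^\star(\Theta_\ell)$ in the child from their mean) among the preselected directions $i$ of that node and the $z\in\mathbb R$ for which both children contain at least $\mathrm{min\_samples\_leaf}_n\in\{1,\dots,n\}$ bootstrap points; ties are broken arbitrarily, and the resulting cells are assumed to depend measurably on $(\Theta_\ell,\mathcal D_n)$. Let $A_n(x;\Theta_\ell,\mathcal D_n)$ be the leaf cell that contains $x$, and let $N_n^b(x;\Theta_\ell,\mathcal D_n)$ be the number of points of $\mathcal D_n^\star(\Theta_\ell)$, with multiplicity, in that cell. With $k=k_n\ge 1$ trees, put $$F_{k,n}^b(y\,|\,x)=\sum_{j=1}^n w_{n,j}^b(x)\,\mathbf 1_{\{Y^j\le y\}},\qquad w_{n,j}^b(x)=\frac1k\sum_{\ell=1}^k\frac{B_j(\Theta_\ell)\,\mathbf 1_{\{X^j\in A_n(x;\Theta_\ell,\mathcal D_n)\}}}{N_n^b(x;\Theta_\ell,\mathcal D_n)} .$$ Write $f(n)=\Omega(g(n))$ if there are $c>0$ and $n_0>0$ with $|f(n)|\ge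 c|g(n)|$ for all $n\ge n_0$, and $\mathrm{CV}(N)=\sigma_N/\mathbb E[N]$. **Theorem.** Assume: 1. For all $\ell\ge1$, $x\in\mathcal X$ and $y\in\mathbb R$: $\ \sup_{z\in A_n(x;\Theta_\ell,\mathcal D_n)}|F(y|z)-F(y|x)|\to0$ almost surely as $n\to\infty$. 2. $k_n=O(n^\alpha)$ for some $\alpha>0$, and, for some $\beta>1$ and $\gamma>1$, at least one of the following holds (for all $\ell$): * for every $x\in\mathcal X$, almost surely, $N_n^b(x;\Theta_\ell,\mathcal D_n)=\Omega(\sqrt n\,(\ln n)^\beta)$ (the constants $c,n_0$ may be random); * for every $x\in\mathcal X$, $\ \mathbb E[N_n^b(x;\Theta_\ell,\mathcal D_n)]=\Omega(\sqrt n\,(\ln n)^\beta)$ and $\mathrm{CV}(N_n^b(x;\Theta_\ell,\mathcal D_n))=O\big(1/(\sqrt n\,(\ln n)^{\gamma/2})\big)$. 3. For every $x\in\mathcal X$, $y\mapsto F(y|x)$ is continuous and strictly increasing. Then, for every $x\in\mathcal X$, $$\sup_{y\in\mathbb R}\big|F_{k_n,n}^b(y\,|\,x)-F(y\,|\,x)\big|\longrightarrow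 0\quad\text{almost surely as } n\to\infty .$$ -/

import Mathlib

open MeasureTheory ProbabilityTheory Filter Topology

/-- An observation `(X, Y)` with `X ∈ ℝ^d` and `Y ∈ ℝ`. -/
abbrev Obs (d : ℕ) : Type := (Fin d → ℝ) × ℝ

/-- A sample of `n` observations. -/
abbrev Sample (d n : ℕ) : Type := Fin n → Obs d

/-- The sets of candidate split directions are discrete data. -/
instance instMeasurableSpaceFinsetFin (d : ℕ) : MeasurableSpace (Finset (Fin d)) := ⊤

/-- The values of the random element `Θ = (Θ¹, Θ²)` that drives one tree. For every sample size `n`,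
`θ.1 n : Fin n → Fin n` lists the indices of the `n` bootstrap draws, and `θ.2 n v` is the set of
preselected split directions at the node with address `v` (the list of left/right moves that lead
from the root to the node, `false` = left and `true` = right). -/
abbrev TreeRandomness (d : ℕ) : Type :=
  (∀ n : ℕ, Fin n → Fin n) × (ℕ → List Bool → Finset (Fin d))

/-- Finite binary trees of cuts perpendicular to the axes. -/
inductive SplitTree (d : ℕ) : Type where
  | leaf : SplitTree d
  | node (i : Fin d) (z : ℝ) (left right : SplitTree d) : SplitTree d

namespace SplitTree

/-- The leaf cell that contains `x` when the tree partitions the region `A`. -/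
noncomputable def cell {d : ℕ} : SplitTree d → Set (Fin d → ℝ) → (Fin d → ℝ) → Set (Fin d → ℝ)
  | leaf, A, _ => A
  | node i z l r, A, x =>
      open Classical in
      if x i < z then l.cell (A ∩ {u | u i < z}) x else r.cell (A ∩ {u | z ≤ u i}) x

end SplitTree

section CART

variable {d n : ℕ}

open Classical in
/-- The indices of the observations of the sample `S` that fall into `A`. -/
noncomputable def indicesIn (S : Sample d n) (A : Set (Fin d → ℝ)) : Finset (Fin n) :=
  Finset.univ.filter fun i => (S i).1 ∈ A

/-- The mean response of the observations of `S` that fall into `A`. -/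
noncomputable def meanIn (S : Sample d n) (A : Set (Fin d → ℝ)) : ℝ :=
  (∑ i ∈ indicesIn S A, (S i).2) / ((indicesIn S A).card : ℝ)

/-- The squared prediction error in `A`. -/
noncomputable def sqErrorIn (S : Sample d n) (A : Set (Fin d → ℝ)) : ℝ :=
  ∑ i ∈ indicesIn S A, ((S i).2 - meanIn S A) ^ 2

/-- The CART-split criterion of the cut `{u | u i < z}`, `{u | z ≤ u i}` of the node `A`: the squared
prediction error in the two child nodes. -/
noncomputable def cartCriterion (S : Sample d n) (A : Set (Fin d → ℝ)) (i : Fin d) (z : ℝ) : ℝ :=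
  sqErrorIn S (A ∩ {u | u i < z}) + sqErrorIn S (A ∩ {u | z ≤ u i})

/-- The cut leaves at least `m` observations of `S` in each of the two child nodes of `A`. -/
def AdmissibleCut (S : Sample d n) (m : ℕ) (A : Set (Fin d → ℝ)) (i : Fin d) (z : ℝ) : Prop :=
  m ≤ (indicesIn S (A ∩ {u | u i < z})).card ∧ m ≤ (indicesIn S (A ∩ {u | z ≤ u i})).card

/-- The cut `(i, z)` of `A` minimizes the CART-split criterion among the admissible cuts along the
preselected directions `J`. -/
def IsBestCut (S : Sample d n) (m : ℕ) (J : Finset (Fin d)) (A : Set (Fin d → ℝ))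
    (i : Fin d) (z : ℝ) : Prop :=
  i ∈ J ∧ AdmissibleCut S m A i z ∧
    ∀ i' ∈ J, ∀ z' : ℝ, AdmissibleCut S m A i' z' → cartCriterion S A i z ≤ cartCriterion S A i' z'

/-- The subtree below the node with address `v` and region `A` is grown by CART on the sample `S`:
every cut is a best cut along the directions preselected at its node. Any stopping rule is allowed,
and so is any choice between several best cuts. -/
def GrownByCART (S : Sample d n) (m : ℕ) (J : List Bool → Finset (Fin d)) :
    List Bool → Set (Fin d → ℝ) → SplitTree d → Prop
  | _, _, .leaf => True
  | v, A, .node i z l r =>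
      IsBestCut S m (J v) A i z ∧
        GrownByCART S m J (v ++ [false]) (A ∩ {u | u i < z}) l ∧
        GrownByCART S m J (v ++ [true]) (A ∩ {u | z ≤ u i}) r

/-- The bootstrap sample `D⋆(Θ)` that consists of the observations with indices `b 0, b 1, …`. -/
def bootstrapSample (b : Fin n → Fin n) (D : Sample d n) : Sample d n := fun i => D (b i)

/-- `B_j`: how often the index `j` is drawn. -/
def drawCount (b : Fin n → Fin n) (j : Fin n) : ℕ :=
  (Finset.univ.filter fun i => b i = j).card

end CART

/-- A rule that grows the trees of a Breiman random forest on the input space `𝒳 ⊆ ℝ^d`: for each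
sample size `n`, the numbers `max_features` and `min_samples_leaf`, and the tree that is grown by
CART with root node `𝒳` on the bootstrap sample. `measurable_cell` says that the cells are
random sets, so that cell counts are random variables. -/
structure BreimanRule (d : ℕ) (𝒳 : Set (Fin d → ℝ)) where
  maxFeatures : ℕ → ℕ
  maxFeatures_mem : ∀ n, maxFeatures n ∈ Finset.Icc 1 d
  minLeaf : ℕ → ℕ
  minLeaf_mem : ∀ n, 1 ≤ n → minLeaf n ∈ Finset.Icc 1 n
  tree : ∀ n : ℕ, TreeRandomness d → Sample d n → SplitTree d
  grown : ∀ (n : ℕ) (θ : TreeRandomness d) (D : Sample d n),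
    GrownByCART (bootstrapSample (θ.1 n) D) (minLeaf n) (θ.2 n) [] 𝒳 (tree n θ D)
  measurable_cell : ∀ (n : ℕ) (x : Fin d → ℝ),
    MeasurableSet {p : (TreeRandomness d × Sample d n) × (Fin d → ℝ) |
      p.2 ∈ (tree n p.1.1 p.1.2).cell 𝒳 x}

namespace BreimanRule

variable {d : ℕ} {𝒳 : Set (Fin d → ℝ)} (R : BreimanRule d 𝒳) {n : ℕ}

/-- The tree cell `A_n(x; θ, D_n)` that contains `x`. -/
noncomputable def cell (x : Fin d → ℝ) (θ : TreeRandomness d) (D : Sample d n) :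
    Set (Fin d → ℝ) :=
  (R.tree n θ D).cell 𝒳 x

/-- `N_n^b(x; θ, D_n)`: the number of elements of the bootstrap sample in the cell of `x`. -/
noncomputable def leafCount (x : Fin d → ℝ) (θ : TreeRandomness d) (D : Sample d n) : ℕ :=
  (indicesIn (bootstrapSample (θ.1 n) D) (R.cell x θ D)).card

open Classical in
/-- The weight `w_{n,j}^b(x; θ_1, …, θ_k, D_n)`. -/
noncomputable def weight (x : Fin d → ℝ) (k : ℕ) (θ : ℕ → TreeRandomness d) (D : Sample d n)
    (j : Fin n) : ℝ :=
  (1 / (k : ℝ)) * ∑ l ∈ Finset.range k,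
    ((drawCount ((θ l).1 n) j : ℝ) * (if (D j).1 ∈ R.cell x (θ l) D then 1 else 0)) /
      (R.leafCount x (θ l) D : ℝ)

open Classical in
/-- The estimator `F_{k,n}^b(y | X = x; θ_1, …, θ_k, D_n)`. -/
noncomputable def cdfEstimator (x : Fin d → ℝ) (k : ℕ) (θ : ℕ → TreeRandomness d) (D : Sample d n)
    (y : ℝ) : ℝ :=
  ∑ j : Fin n, R.weight x k θ D j * (if (D j).2 ≤ y then 1 else 0)

end BreimanRule

/-- `f(n) = Ω(g(n))`. -/
def IsBigOmega (f g : ℕ → ℝ) : Prop :=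
  ∃ c : ℝ, 0 < c ∧ ∃ n₀ : ℕ, 0 < n₀ ∧ ∀ n, n₀ ≤ n → c * |g n| ≤ |f n|

/-- The coefficient of variation `σ_X / E[X]`. -/
noncomputable def coeffVar {Ω : Type*} [MeasurableSpace Ω] (X : Ω → ℝ) (μ : Measure Ω) : ℝ :=
  Real.sqrt (variance X μ) / ∫ ω, X ω ∂μ

/-- `D_n`: the first `n` observations of the sequence `Z`. -/
def firstObs {d : ℕ} {Ω : Type*} (Z : ℕ → Ω → Obs d) (n : ℕ) (ω : Ω) : Sample d n :=
  fun j => Z j ω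

/-!
The forest estimator is the average over the trees `l < k n` of the estimators `treeCdf` of the
single trees, so the proof is in three steps: a single tree is consistent at every level `y`,
averaging over the trees preserves consistency, and Pólya's theorem makes it uniform in `y`.

*A single tree.* The error of a tree is at most the oscillation of `F(y | ·)` over the cell, which
tends to zero by assumption, plus the noise `|∑ j, B_j 1_{X_j ∈ A} (1_{Y_j ≤ y} - F(y | X_j))| / N`
(`BreimanRule.abs_treeCdf_sub_cdf_le`). The cell `A` depends on the responses, but it is the trace on
the root region of a product of intervals, so it selects the same observations as one of the
`n ^ (2 d)` boxes that are spanned by sample points (`exists_sampleBox_trace`), and such a box is a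
function of the inputs alone. Given the inputs and the bootstrap draws, the noise over such a box is
a sum of independent centered variables with weights at most `B_j`, and Hoeffding's inequality applies
(`measure_pi_le_abs_weighted_sum`, which rests on the conditional independence expressed by
`lintegral_prod_pi_compProd_le`). As `B_j` has exponential tails (`uniformOn_le_drawCount`), all `B_j`
are `O(log n)`, whence `∑ j, B_j ^ 2 = O(n * log n)`, and a union bound shows that the noise sums are
`O(√n * log n)` uniformly over the boxes (`ae_eventually_abs_noiseSum_lt`). This is negligible with
respect to a leaf count of order `√n * (log n) ^ β`, `β > 1`. Under the assumption on the coefficients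
of variation, Chebyshev's inequality gives leaf counts of that order (`ae_isBigOmega_of_coeffVar`).

*The average.* Given the sample, the errors of the trees are i.i.d. functions of the `Θ l` with values
in `[0, 1]`. The strong law of large numbers, applied to their suprema over `n ≥ N`, shows that the
averages tend to zero, whether or not `k n` tends to infinity (`ae_tendsto_average_of_iid_of_indep`).
-/

/-! ### Pólya's theorem -/

/-- Pólya: pointwise convergence on the rationals of monotone functions with values in `[0, 1]` to
a continuous distribution function is uniform. -/
theorem tendsto_iSup_abs_sub_of_tendsto_rat {G : ℕ → ℝ → ℝ} {F : ℝ → ℝ}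
    (hG : ∀ n, Monotone (G n)) (hG0 : ∀ n y, 0 ≤ G n y) (hG1 : ∀ n y, G n y ≤ 1)
    (hF : Monotone F) (hFc : Continuous F) (hFbot : Tendsto F atBot (𝓝 0))
    (hFtop : Tendsto F atTop (𝓝 1))
    (h : ∀ q : ℚ, Tendsto (fun n => G n q) atTop (𝓝 (F q))) :
    Tendsto (fun n => ⨆ y : ℝ, |G n y - F y|) atTop (𝓝 0) := by
  have hF0 : ∀ y, 0 ≤ F y := fun y => hF.le_of_tendsto hFbot y
  have hF1 : ∀ y, F y ≤ 1 := fun y => hF.ge_of_tendsto hFtop y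
  have key : ∀ ε : ℝ, 0 < ε → ∀ᶠ n in atTop, ∀ y, |G n y - F y| ≤ ε := by
    intro ε hε
    have hq : ∀ q : ℚ, ∀ᶠ n in atTop, |G n q - F q| ≤ ε / 2 := fun q => by
      have := (tendsto_order.1 (tendsto_iff_norm_sub_tendsto_zero.1 (h q))).2 (ε / 2) (by positivity)
      filter_upwards [this] with n hn using hn.le
    -- rational points beyond which `F` is close to its limits
    obtain ⟨a, ha⟩ : ∃ a : ℚ, F a < ε / 2 := by
      obtain ⟨r, hr⟩ := ((tendsto_order.1 hFbot).2 (ε / 2) (by positivity)).exists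
      obtain ⟨a, ha⟩ := exists_rat_lt r
      exact ⟨a, (hF ha.le).trans_lt hr⟩
    obtain ⟨b, hb⟩ : ∃ b : ℚ, 1 - ε / 2 < F b := by
      obtain ⟨r, hr⟩ := ((tendsto_order.1 hFtop).1 (1 - ε / 2) (by linarith)).exists
      obtain ⟨b, hb⟩ := exists_rat_gt r
      exact ⟨b, hr.trans_le (hF hb.le)⟩
    have hmid : ∀ᶠ n in atTop, ∀ y ∈ Set.Icc (a : ℝ) b, |G n y - F y| ≤ ε := by
      refine isCompact_Icc.induction_on
        (p := fun s => ∀ᶠ n in atTop, ∀ y ∈ s, |G n y - F y| ≤ ε) ?_ ?_ ?_ ?_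
      · simp
      · intro s t hst ht
        filter_upwards [ht] with n hn y hy using hn y (hst hy)
      · intro s t hs ht
        filter_upwards [hs, ht] with n hn hn' y hy using hy.elim (hn y) (hn' y)
      · intro x _
        have hc := Metric.continuousAt_iff.1 (hFc.continuousAt (x := x)) (ε / 4) (by positivity)
        obtain ⟨δ, hδ, hx⟩ := hc
        obtain ⟨p, hp1, hp2⟩ := exists_rat_btwn (show x - δ < x by linarith)
        obtain ⟨q, hq1, hq2⟩ := exists_rat_btwn (show x < x + δ by linarith)
        refine ⟨Set.Ioo (p : ℝ) q, mem_nhdsWithin_of_mem_nhds (Ioo_mem_nhds hp2 hq1), ?_⟩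
        filter_upwards [hq p, hq q] with n hnp hnq y hy
        have e1 := hx (x := p) (by rw [Real.dist_eq, abs_lt]; constructor <;> linarith)
        have e2 := hx (x := q) (by rw [Real.dist_eq, abs_lt]; constructor <;> linarith)
        rw [Real.dist_eq, abs_lt] at e1 e2
        rw [abs_le] at hnp hnq ⊢
        have := hG n hy.1.le
        have := hG n hy.2.le
        have := hF hy.1.le
        have := hF hy.2.le
        constructor <;> linarith
    filter_upwards [hmid, hq a, hq b] with n hn hna hnb y
    rw [abs_le] at hna hnb
    rcases lt_or_ge y a with hy | hy
    · have := hG n hy.le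
      have := hF hy.le
      have := hG0 n y
      have := hF0 y
      rw [abs_le]
      constructor <;> linarith
    rcases lt_or_ge (b : ℝ) y with hy' | hy'
    · have := hG n hy'.le
      have := hF hy'.le
      have := hG1 n y
      have := hF1 y
      rw [abs_le]
      constructor <;> linarith
    exact hn y ⟨hy, hy'⟩
  rw [tendsto_order]
  refine ⟨fun a ha => Eventually.of_forall fun n =>
    ha.trans_le (Real.iSup_nonneg fun y => abs_nonneg _), fun a ha => ?_⟩
  filter_upwards [key (a / 2) (by positivity)] with n hn
  exact (Real.iSup_le hn (by positivity)).trans_lt (by linarith)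

/-! ### Averages over independent copies -/

section Average

variable {Ω E G : Type*} [MeasurableSpace Ω] [MeasurableSpace E] [MeasurableSpace G]
  {μ : Measure Ω} [IsProbabilityMeasure μ]

/-- If `h n → 0` almost surely along each of the i.i.d. elements `Θ l`, then so do the averages of
`h n` over the first `k n` of them, however the `k n` behave: the strong law of large numbers
applies to the suprema `⨆ n ≥ N, h n`, whose expectations tend to zero. -/
theorem ae_tendsto_average_of_iid {h : ℕ → E → ℝ} (hm : ∀ n, Measurable (h n))
    (h0 : ∀ n e, 0 ≤ h n e) (h1 : ∀ n e, h n e ≤ 1) {Θ : ℕ → Ω → E} (hΘm : ∀ l, Measurable (Θ l))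
    (hΘi : iIndepFun Θ μ) (hΘd : ∀ l, IdentDistrib (Θ l) (Θ 0) μ μ) (k : ℕ → ℕ)
    (hlim : ∀ l, ∀ᵐ ω ∂μ, Tendsto (fun n => h n (Θ l ω)) atTop (𝓝 0)) :
    ∀ᵐ ω ∂μ, Tendsto (fun n => (1 / (k n : ℝ)) * ∑ l ∈ Finset.range (k n), h n (Θ l ω))
      atTop (𝓝 0) := by
  set H : ℕ → E → ℝ := fun N e => ⨆ n, h (N + n) e with hH
  have hbdd : ∀ N e, BddAbove (Set.range fun n => h (N + n) e) := fun N e =>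
    ⟨1, by rintro _ ⟨n, rfl⟩; exact h1 _ _⟩
  have hHm : ∀ N, Measurable (H N) := fun N => Measurable.iSup fun n => hm _
  have hH0 : ∀ N e, 0 ≤ H N e := fun N e => Real.iSup_nonneg fun n => h0 _ _
  have hH1 : ∀ N e, H N e ≤ 1 := fun N e => ciSup_le fun n => h1 _ _
  have hle : ∀ N n e, N ≤ n → h n e ≤ H N e := fun N n e hn => by
    obtain ⟨m, rfl⟩ := Nat.exists_eq_add_of_le hn
    exact le_ciSup (hbdd N e) m
  have hslln : ∀ N, ∀ᵐ ω ∂μ, Tendsto (fun K : ℕ => (∑ l ∈ Finset.range K, H N (Θ l ω)) / (K : ℝ))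
      atTop (𝓝 (∫ ω, H N (Θ 0 ω) ∂μ)) := by
    intro N
    refine strong_law_ae_real (fun l ω => H N (Θ l ω)) ?_ ?_ ?_
    · refine Integrable.of_bound ((hHm N).comp (hΘm 0)).aestronglyMeasurable 1 ?_
      exact Eventually.of_forall fun ω => by
        rw [Real.norm_of_nonneg (hH0 _ _)]; exact hH1 _ _
    · exact fun i j hij => (hΘi.indepFun hij).comp (hHm N) (hHm N)
    · exact fun i => (hΘd i).comp (hHm N)
  have hint : Tendsto (fun N => ∫ ω, H N (Θ 0 ω) ∂μ) atTop (𝓝 0) := by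
    have : Tendsto (fun N => ∫ ω, H N (Θ 0 ω) ∂μ) atTop (𝓝 (∫ _ : Ω, (0 : ℝ) ∂μ)) := by
      refine tendsto_integral_of_dominated_convergence (fun _ => 1)
        (fun N => ((hHm N).comp (hΘm 0)).aestronglyMeasurable) (integrable_const _) ?_ ?_
      · intro N
        exact Eventually.of_forall fun ω => by
          rw [Real.norm_of_nonneg (hH0 _ _)]; exact hH1 _ _
      · filter_upwards [hlim 0] with ω hω
        rw [tendsto_order]
        refine ⟨fun a ha => Eventually.of_forall fun N => ha.trans_le (hH0 _ _), fun a ha => ?_⟩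
        obtain ⟨N₀, hN₀⟩ := eventually_atTop.1 ((tendsto_order.1 hω).2 (a / 2) (by positivity))
        filter_upwards [eventually_ge_atTop N₀] with N hN
        exact (ciSup_le fun n => (hN₀ (N + n) (by omega)).le).trans_lt (by linarith)
    simpa using this
  filter_upwards [ae_all_iff.2 hslln, ae_all_iff.2 hlim] with ω hω hωl
  rw [tendsto_order]
  refine ⟨fun a ha => Eventually.of_forall fun n => ha.trans_le
    (mul_nonneg (by positivity) (Finset.sum_nonneg fun l _ => h0 _ _)), fun a ha => ?_⟩
  obtain ⟨N, hN⟩ := ((tendsto_order.1 hint).2 a ha).exists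
  obtain ⟨K₀, hK₀⟩ := eventually_atTop.1 ((tendsto_order.1 (hω N)).2 a hN)
  -- the indices `n` with `k n < K₀` involve only finitely many of the `Θ l`
  have hsmall : ∀ᶠ n in atTop, ∀ l ∈ Finset.range K₀, h n (Θ l ω) < a / 2 :=
    (Filter.eventually_all_finset _).2 fun l _ =>
      (tendsto_order.1 (hωl l)).2 (a / 2) (by positivity)
  filter_upwards [hsmall, eventually_ge_atTop N] with n hn hnN
  rcases le_or_gt K₀ (k n) with hk | hk
  · refine lt_of_le_of_lt ?_ (hK₀ (k n) hk)
    rw [one_div, inv_mul_eq_div]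
    gcongr with l _
    exact hle N n _ hnN
  · rcases Nat.eq_zero_or_pos (k n) with h00 | hpos
    · simpa [h00] using ha
    · have hk0 : (0 : ℝ) < k n := by exact_mod_cast hpos
      have : ∑ l ∈ Finset.range (k n), h n (Θ l ω) ≤ ∑ l ∈ Finset.range (k n), a / 2 :=
        Finset.sum_le_sum fun l hl => (hn l (by simp at hl ⊢; omega)).le
      rw [Finset.sum_const, Finset.card_range, nsmul_eq_mul] at this
      rw [one_div, inv_mul_lt_iff₀ hk0]
      nlinarith

/-- The averages of `g n (Θ l) ζ` over i.i.d. elements `Θ l` that are independent of `ζ`: Fubini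
reduces the statement to a fixed value of `ζ`. -/
theorem ae_tendsto_average_of_iid_of_indep {g : ℕ → E × G → ℝ} (hm : ∀ n, Measurable (g n))
    (h0 : ∀ n p, 0 ≤ g n p) (h1 : ∀ n p, g n p ≤ 1) {Θ : ℕ → Ω → E} (hΘm : ∀ l, Measurable (Θ l))
    (hΘi : iIndepFun Θ μ) (hΘd : ∀ l, IdentDistrib (Θ l) (Θ 0) μ μ)
    {ζ : Ω → G} (hζ : Measurable ζ) (hΘζ : IndepFun (fun ω l => Θ l ω) ζ μ) (k : ℕ → ℕ)
    (hlim : ∀ l, ∀ᵐ ω ∂μ, Tendsto (fun n => g n (Θ l ω, ζ ω)) atTop (𝓝 0)) :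
    ∀ᵐ ω ∂μ, Tendsto (fun n => (1 / (k n : ℝ)) * ∑ l ∈ Finset.range (k n), g n (Θ l ω, ζ ω))
      atTop (𝓝 0) := by
  have hΘ' : Measurable (fun ω l => Θ l ω) := measurable_pi_lambda _ hΘm
  have := Measure.isProbabilityMeasure_map (μ := μ) hζ.aemeasurable
  have := Measure.isProbabilityMeasure_map (μ := μ) hΘ'.aemeasurable
  have hprod : μ.map (fun ω => (ζ ω, fun l => Θ l ω)) =
      (μ.map ζ).prod (μ.map fun ω l => Θ l ω) :=
    (indepFun_iff_map_prod_eq_prod_map_map hζ.aemeasurable hΘ'.aemeasurable).1 hΘζ.symm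
  have hpair : AEMeasurable (fun ω => (ζ ω, fun l => Θ l ω)) μ := (hζ.prodMk hΘ').aemeasurable
  have hfix : ∀ l, ∀ᵐ z ∂(μ.map ζ), ∀ᵐ ω ∂μ, Tendsto (fun n => g n (Θ l ω, z)) atTop (𝓝 0) := by
    intro l
    have hS : MeasurableSet {p : G × (ℕ → E) | Tendsto (fun n => g n (p.2 l, p.1)) atTop (𝓝 0)} :=
      measurableSet_tendsto _ fun n => (hm n).comp (by fun_prop)
    have h2 : ∀ᵐ p ∂((μ.map ζ).prod (μ.map fun ω l => Θ l ω)),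
        Tendsto (fun n => g n (p.2 l, p.1)) atTop (𝓝 0) := by
      rw [← hprod, ae_map_iff hpair hS]
      exact hlim l
    filter_upwards [Measure.ae_ae_of_ae_prod h2] with z hz
    exact ae_of_ae_map hΘ'.aemeasurable hz
  have hS : MeasurableSet {p : G × (ℕ → E) | Tendsto (fun n => (1 / (k n : ℝ)) *
      ∑ l ∈ Finset.range (k n), g n (p.2 l, p.1)) atTop (𝓝 0)} :=
    measurableSet_tendsto _ fun n => (Finset.measurable_sum _ fun l _ =>
      (hm n).comp (by fun_prop)).const_mul _
  have hfin : ∀ᵐ p ∂((μ.map ζ).prod (μ.map fun ω l => Θ l ω)), Tendsto (fun n => (1 / (k n : ℝ)) *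
      ∑ l ∈ Finset.range (k n), g n (p.2 l, p.1)) atTop (𝓝 0) := by
    rw [Measure.ae_prod_iff_ae_ae hS]
    filter_upwards [ae_all_iff.2 hfix] with z hz
    refine (ae_map_iff hΘ'.aemeasurable (measurable_prodMk_left (x := z) hS)).2 ?_
    exact ae_tendsto_average_of_iid (h := fun n e => g n (e, z))
      (fun n => (hm n).comp (by fun_prop)) (fun n e => h0 _ _) (fun n e => h1 _ _) hΘm hΘi hΘd k hz
  rw [← hprod] at hfin
  exact ae_of_ae_map hpair hfin

end Average

/-! ### A Hoeffding inequality with weights that depend on the inputs -/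

section Hoeffding

variable {E F : Type*} [MeasurableSpace E] [MeasurableSpace F]

/-- Under the law of `n` independent pairs `(x j, y j)`, the `y j` are independent given the vector
of all the `x i`, so that a product over `j` of functions of that vector and of `y j` may be integrated
factor by factor. By induction on `n`: Tonelli's theorem allows integrating `y 0` first. -/
theorem lintegral_prod_pi_compProd_le (ν : Measure E) [IsProbabilityMeasure ν] (κ : Kernel E F)
    [IsMarkovKernel κ] {n : ℕ} (h : Fin n → (Fin n → E) → F → ENNReal)
    (hm : ∀ j, Measurable (Function.uncurry (h j))) (K : Fin n → ENNReal)
    (hK : ∀ j x, ∫⁻ y, h j x y ∂κ (x j) ≤ K j) :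
    ∫⁻ w, ∏ j, h j (fun i => (w i).1) (w j).2 ∂Measure.pi (fun _ : Fin n => ν ⊗ₘ κ) ≤
      ∏ j, K j := by
  induction n with
  | zero => simp
  | succ n ih =>
    have hmp := (measurePreserving_piFinSuccAbove (fun _ : Fin (n + 1) => ν ⊗ₘ κ) 0).symm
    have hmeas : Measurable fun w : Fin (n + 1) → E × F =>
        ∏ j, h j (fun i => (w i).1) (w j).2 :=
      Finset.measurable_prod _ fun j _ => (hm j).comp (by fun_prop :
        Measurable fun w : Fin (n + 1) → E × F => ((fun i => (w i).1), (w j).2))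
    have hcons : Measurable fun p : E × (Fin n → E) => (Fin.cons p.1 p.2 : Fin (n + 1) → E) := by
      refine measurable_pi_lambda _ fun i => ?_
      refine Fin.cases ?_ (fun i => ?_) i
      · simpa using measurable_fst
      · simpa using (by fun_prop : Measurable fun p : E × (Fin n → E) => p.2 i)
    set P : E → (Fin n → E × F) → ENNReal := fun x w =>
      ∏ j : Fin n, h j.succ (Fin.cons x fun i => (w i).1) (w j).2 with hP
    have hPm : Measurable (Function.uncurry P) := by
      refine Finset.measurable_prod _ fun j _ => ?_
      have hX : Measurable fun p : E × (Fin n → E × F) =>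
          ((Fin.cons p.1 fun i => (p.2 i).1 : Fin (n + 1) → E), (p.2 j).2) :=
        (hcons.comp (by fun_prop : Measurable fun p : E × (Fin n → E × F) =>
          (p.1, fun i => (p.2 i).1))).prodMk (by fun_prop)
      exact (hm j.succ).comp hX
    rw [← hmp.lintegral_comp hmeas]
    have hsplit : ∀ p : (E × F) × (Fin n → E × F),
        ∏ j, h j (fun i => ((MeasurableEquiv.piFinSuccAbove (fun _ => E × F) 0).symm p i).1)
          ((MeasurableEquiv.piFinSuccAbove (fun _ => E × F) 0).symm p j).2 =
        h 0 (Fin.cons p.1.1 fun i => (p.2 i).1) p.1.2 * P p.1.1 p.2 := by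
      intro p
      have e : ∀ i, (MeasurableEquiv.piFinSuccAbove (fun _ => E × F) 0).symm p i =
          (Fin.cons p.1 p.2 : Fin (n + 1) → E × F) i := fun i => by
        simp [MeasurableEquiv.piFinSuccAbove, Fin.insertNthEquiv]
      have e1 : (fun i => ((Fin.cons p.1 p.2 : Fin (n + 1) → E × F) i).1) =
          Fin.cons p.1.1 fun i => (p.2 i).1 := by
        funext i
        refine Fin.cases ?_ (fun i => ?_) i <;> simp
      simp_rw [e]
      rw [Fin.prod_univ_succ, e1]
      simp [hP]
    simp_rw [hsplit]
    have hm0 : Measurable fun p : (E × F) × (Fin n → E × F) =>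
        h 0 (Fin.cons p.1.1 fun i => (p.2 i).1) p.1.2 * P p.1.1 p.2 := by
      have hX : Measurable fun p : (E × F) × (Fin n → E × F) =>
          ((Fin.cons p.1.1 fun i => (p.2 i).1 : Fin (n + 1) → E), p.1.2) :=
        (hcons.comp (by fun_prop : Measurable fun p : (E × F) × (Fin n → E × F) =>
          (p.1.1, fun i => (p.2 i).1))).prodMk (by fun_prop)
      exact ((hm 0).comp hX).mul (hPm.comp
        (by fun_prop : Measurable fun p : (E × F) × (Fin n → E × F) => (p.1.1, p.2)))
    have hinner : ∀ w : Fin n → E × F,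
        ∫⁻ z, h 0 (Fin.cons z.1 fun i => (w i).1) z.2 * P z.1 w ∂(ν ⊗ₘ κ) ≤
          ∫⁻ x, K 0 * P x w ∂ν := by
      intro w
      rw [Measure.lintegral_compProd
        (f := fun z : E × F => h 0 (Fin.cons z.1 fun i => (w i).1) z.2 * P z.1 w)
        (hm0.comp (by fun_prop : Measurable fun z : E × F => (z, w)))]
      refine lintegral_mono fun x => ?_
      have hmx : Measurable fun y => h 0 (Fin.cons x fun i => (w i).1) y :=
        (hm 0).comp measurable_prodMk_left
      refine (lintegral_mul_const (P x w) hmx).trans_le ?_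
      gcongr
      simpa using hK 0 (Fin.cons x fun i => (w i).1)
    rw [lintegral_prod_symm _ hm0.aemeasurable]
    calc _ ≤ ∫⁻ w, ∫⁻ x, K 0 * P x w ∂ν ∂Measure.pi (fun _ : Fin n => ν ⊗ₘ κ) :=
          lintegral_mono fun w => hinner w
      _ = ∫⁻ x, ∫⁻ w, K 0 * P x w ∂Measure.pi (fun _ : Fin n => ν ⊗ₘ κ) ∂ν := by
          refine (lintegral_lintegral_swap ?_).symm
          exact (hPm.const_mul _).aemeasurable
      _ ≤ ∫⁻ _, ∏ j, K j ∂ν := by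
          refine lintegral_mono fun x => ?_
          have hmx : Measurable (P x) := hPm.comp measurable_prodMk_left
          rw [lintegral_const_mul _ hmx, Fin.prod_univ_succ]
          gcongr
          refine ih (fun j x' y => h j.succ (Fin.cons x x') y) (fun j => ?_) _ fun j x' => ?_
          · exact (hm j.succ).comp ((hcons.comp (by fun_prop : Measurable
              fun p : (Fin n → E) × F => (x, p.1))).prodMk measurable_snd)
          · simpa using hK j.succ (Fin.cons x x')
      _ = _ := by simp

/-- The exponential Markov inequality for `∑ j, c j (x) * ξ (x j) (y j)`, where the weights `c j` may
depend on all of the inputs. -/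
theorem measure_pi_le_weighted_sum (ν : Measure E) [IsProbabilityMeasure ν] (κ : Kernel E F)
    [IsMarkovKernel κ] {ξ : E → F → ℝ} (hξm : Measurable (Function.uncurry ξ))
    (a : E → ℝ) (hξ : ∀ x y, ξ x y ∈ Set.Icc (a x) (a x + 1)) (hξ0 : ∀ x, ∫ y, ξ x y ∂κ x = 0)
    {n : ℕ} (c : Fin n → (Fin n → E) → ℝ) (hc : ∀ j, Measurable (c j)) (C : Fin n → ℝ)
    (hcC : ∀ j x, |c j x| ≤ C j) {V : ℝ} (hV : 0 < V) (hCV : ∑ j, C j ^ 2 ≤ V)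
    {t : ℝ} (ht : 0 ≤ t) :
    Measure.pi (fun _ : Fin n => ν ⊗ₘ κ)
      {w | t ≤ ∑ j, c j (fun i => (w i).1) * ξ (w j).1 (w j).2} ≤
      ENNReal.ofReal (Real.exp (-(t ^ 2 / (2 * V)))) := by
  -- the value that minimizes `s ^ 2 * V / 2 - s * t`
  set s : ℝ := t / V with hs
  have hs0 : 0 ≤ s := by positivity
  have hmgf : ∀ x u, ∫⁻ y, ENNReal.ofReal (Real.exp (u * ξ x y)) ∂κ x ≤
      ENNReal.ofReal (Real.exp (u ^ 2 / 2)) := by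
    intro x u
    have hmx : Measurable (ξ x) := hξm.comp measurable_prodMk_left
    have hsub := hasSubgaussianMGF_of_mem_Icc (μ := κ x) (X := ξ x) hmx.aemeasurable
      (Eventually.of_forall (hξ x))
    rw [hξ0 x] at hsub
    simp only [sub_zero] at hsub
    have h1 := hsub.mgf_le u
    rw [← ofReal_integral_eq_lintegral_ofReal (hsub.integrable_exp_mul u)
      (Eventually.of_forall fun y => (Real.exp_pos _).le)]
    refine ENNReal.ofReal_le_ofReal (h1.trans (Real.exp_le_exp.2 ?_))
    have : ((‖a x + 1 - a x‖₊ / 2) ^ 2 : NNReal) = (1 / 4 : NNReal) := by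
      rw [add_sub_cancel_left, nnnorm_one]; norm_num
    rw [this]
    push_cast
    nlinarith [sq_nonneg u]
  have hmain := lintegral_prod_pi_compProd_le ν κ
    (fun j x y => ENNReal.ofReal (Real.exp ((s * c j x) * ξ (x j) y)))
    (fun j => by
      refine ENNReal.measurable_ofReal.comp (Real.measurable_exp.comp (Measurable.mul ?_ ?_))
      · exact ((hc j).comp measurable_fst).const_mul s
      · exact hξm.comp (by fun_prop : Measurable fun p : (Fin n → E) × F => (p.1 j, p.2)))
    (fun j => ENNReal.ofReal (Real.exp ((s * C j) ^ 2 / 2)))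
    (fun j x => (hmgf (x j) _).trans (ENNReal.ofReal_le_ofReal (Real.exp_le_exp.2 (by
      rw [mul_pow, mul_pow, ← sq_abs (c j x)]
      have := hcC j x
      gcongr))))
  have hsumm : Measurable fun w : Fin n → E × F =>
      ∑ j, c j (fun i => (w i).1) * ξ (w j).1 (w j).2 :=
    Finset.measurable_sum _ fun j _ => ((hc j).comp (by fun_prop)).mul (hξm.comp (by fun_prop))
  have hmarkov := mul_meas_ge_le_lintegral₀ (μ := Measure.pi (fun _ : Fin n => ν ⊗ₘ κ))
    (f := fun w => ENNReal.ofReal (Real.exp (s * ∑ j, c j (fun i => (w i).1) * ξ (w j).1 (w j).2)))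
    (by fun_prop) (ENNReal.ofReal (Real.exp (s * t)))
  have hint : ∫⁻ w, ENNReal.ofReal (Real.exp (s * ∑ j, c j (fun i => (w i).1) * ξ (w j).1 (w j).2))
      ∂Measure.pi (fun _ : Fin n => ν ⊗ₘ κ) ≤ ENNReal.ofReal (Real.exp (s ^ 2 * V / 2)) := by
    refine le_trans (le_of_eq ?_) (hmain.trans ?_)
    · refine lintegral_congr fun w => ?_
      rw [← ENNReal.ofReal_prod_of_nonneg fun _ _ => (Real.exp_pos _).le, ← Real.exp_sum,
        Finset.mul_sum]
      simp_rw [mul_assoc]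
    · rw [← ENNReal.ofReal_prod_of_nonneg fun _ _ => (Real.exp_pos _).le, ← Real.exp_sum]
      refine ENNReal.ofReal_le_ofReal (Real.exp_le_exp.2 ?_)
      rw [← Finset.sum_div]
      simp_rw [mul_pow]
      rw [← Finset.mul_sum]
      gcongr
  have hsub : {w : Fin n → E × F | t ≤ ∑ j, c j (fun i => (w i).1) * ξ (w j).1 (w j).2} ⊆
      {w | ENNReal.ofReal (Real.exp (s * t)) ≤
        ENNReal.ofReal (Real.exp (s * ∑ j, c j (fun i => (w i).1) * ξ (w j).1 (w j).2))} :=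
    fun w hw => ENNReal.ofReal_le_ofReal (Real.exp_le_exp.2 (mul_le_mul_of_nonneg_left hw hs0))
  have hpos : ENNReal.ofReal (Real.exp (s * t)) ≠ 0 := by
    simp [Real.exp_pos]
  calc _ ≤ _ := measure_mono hsub
    _ ≤ ENNReal.ofReal (Real.exp (s ^ 2 * V / 2)) / ENNReal.ofReal (Real.exp (s * t)) := by
        rw [ENNReal.le_div_iff_mul_le (Or.inl hpos) (Or.inl ENNReal.ofReal_ne_top), mul_comm]
        exact hmarkov.trans hint
    _ = _ := by
        rw [← ENNReal.ofReal_div_of_pos (Real.exp_pos _), ← Real.exp_sub]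
        congr 2
        rw [hs]
        field_simp
        ring

/-- Two-sided version of `measure_pi_le_weighted_sum`. -/
theorem measure_pi_le_abs_weighted_sum (ν : Measure E) [IsProbabilityMeasure ν] (κ : Kernel E F)
    [IsMarkovKernel κ] {ξ : E → F → ℝ} (hξm : Measurable (Function.uncurry ξ))
    (a : E → ℝ) (hξ : ∀ x y, ξ x y ∈ Set.Icc (a x) (a x + 1)) (hξ0 : ∀ x, ∫ y, ξ x y ∂κ x = 0)
    {n : ℕ} (c : Fin n → (Fin n → E) → ℝ) (hc : ∀ j, Measurable (c j)) (C : Fin n → ℝ)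
    (hcC : ∀ j x, |c j x| ≤ C j) {V : ℝ} (hV : 0 < V) (hCV : ∑ j, C j ^ 2 ≤ V)
    {t : ℝ} (ht : 0 ≤ t) :
    Measure.pi (fun _ : Fin n => ν ⊗ₘ κ)
      {w | t ≤ |∑ j, c j (fun i => (w i).1) * ξ (w j).1 (w j).2|} ≤
      2 * ENNReal.ofReal (Real.exp (-(t ^ 2 / (2 * V)))) := by
  have h1 := measure_pi_le_weighted_sum ν κ hξm a hξ hξ0 c hc C hcC hV hCV ht
  have h2 := measure_pi_le_weighted_sum ν κ hξm a hξ hξ0 (fun j x => -c j x)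
    (fun j => (hc j).neg) C (fun j x => by simpa using hcC j x) hV hCV ht
  rw [two_mul]
  refine (measure_mono fun w hw => ?_).trans ((measure_union_le _ _).trans (add_le_add h1 h2))
  rcases le_abs.1 (show t ≤ |_| from hw) with h | h
  · exact Or.inl h
  · right
    simpa [Finset.sum_neg_distrib] using h

end Hoeffding

/-! ### Bootstrap counts -/

section Bootstrap

variable {d n : ℕ}

theorem sum_drawCount (b : Fin n → Fin n) : ∑ j, drawCount b j = n := by
  simpa [drawCount] using
    (Finset.card_eq_sum_card_fiberwise (f := b) (s := Finset.univ) (t := Finset.univ)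
      (fun _ _ => Finset.mem_univ _)).symm

/-- Summing over the draws is summing over the observations with their multiplicities. -/
theorem sum_drawCount_mul (b : Fin n → Fin n) (f : Fin n → ℝ) :
    ∑ j, (drawCount b j : ℝ) * f j = ∑ i, f (b i) := by
  rw [← Finset.sum_fiberwise Finset.univ b fun i => f (b i)]
  refine Finset.sum_congr rfl fun j _ => ?_
  rw [Finset.sum_congr rfl (g := fun _ => f j) fun i hi => by rw [(Finset.mem_filter.1 hi).2],
    Finset.sum_const, nsmul_eq_mul, drawCount]

/-- Exponential tail of the number of times that an index is drawn: by independence of the draws,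
the exponential moment of `B_j` is `(1 + (e - 1) / n) ^ n ≤ exp 2`. -/
theorem uniformOn_le_drawCount (j : Fin n) (m : ℝ) :
    (uniformOn Set.univ : Measure (Fin n → Fin n)) {b | m ≤ drawCount b j} ≤
      ENNReal.ofReal (Real.exp (2 - m)) := by
  classical
  have hn : 0 < n := j.pos
  have hn' : (0 : ℝ) < n := by exact_mod_cast hn
  set s : Finset (Fin n → Fin n) := Finset.univ.filter fun b => m ≤ drawCount b j with hs
  have hmom : ∑ b : Fin n → Fin n, Real.exp (drawCount b j) = (n - 1 + Real.exp 1) ^ n := by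
    have h1 : ∀ b : Fin n → Fin n, Real.exp (drawCount b j) =
        ∏ i, if b i = j then Real.exp 1 else 1 := by
      intro b
      rw [Finset.prod_ite, Finset.prod_const, Finset.prod_const_one, mul_one, drawCount,
        ← Real.exp_nat_mul, mul_one]
    simp_rw [h1]
    have h2 := Finset.prod_univ_sum (fun _ : Fin n => (Finset.univ : Finset (Fin n)))
      (fun _ v => if v = j then Real.exp 1 else (1 : ℝ))
    rw [Fintype.piFinset_univ] at h2
    rw [← h2, Finset.prod_const, Finset.card_univ, Fintype.card_fin]
    congr 1
    rw [Finset.sum_ite, Finset.sum_const, Finset.sum_const, Finset.filter_eq' Finset.univ j,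
      Finset.filter_ne' Finset.univ j]
    simp [Nat.cast_sub (show 1 ≤ n from hn)]
    ring
  have hbound : (n - 1 + Real.exp 1) ^ n ≤ (n : ℝ) ^ n * Real.exp 2 := by
    have h3 : (n : ℝ) - 1 + Real.exp 1 ≤ n * Real.exp (2 / n) := by
      have := Real.add_one_le_exp (2 / n : ℝ)
      have h4 : (n : ℝ) * (2 / n + 1) ≤ n * Real.exp (2 / n) := by gcongr
      have h5 : (n : ℝ) * (2 / n + 1) = 2 + n := by field_simp
      have := Real.exp_one_lt_three
      linarith
    calc _ ≤ (n * Real.exp (2 / n)) ^ n := by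
          gcongr
          have : (1 : ℝ) ≤ n := by exact_mod_cast hn
          have := Real.exp_pos 1
          linarith
      _ = _ := by
          rw [mul_pow, ← Real.exp_nat_mul]
          congr 2
          field_simp
  have hcard : (s.card : ℝ) * Real.exp m ≤ (n : ℝ) ^ n * Real.exp 2 := by
    refine le_trans ?_ (hmom.le.trans hbound)
    calc (s.card : ℝ) * Real.exp m = ∑ b ∈ s, Real.exp m := by simp
      _ ≤ ∑ b ∈ s, Real.exp (drawCount b j) :=
          Finset.sum_le_sum fun b hb => Real.exp_le_exp.2 (Finset.mem_filter.1 hb).2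
      _ ≤ _ := Finset.sum_le_sum_of_subset_of_nonneg (Finset.subset_univ _)
          fun _ _ _ => (Real.exp_pos _).le
  have hset : {b : Fin n → Fin n | m ≤ drawCount b j} = (s : Set (Fin n → Fin n)) := by
    ext b; simp [hs]
  rw [uniformOn_univ, hset, Measure.count_apply_finset]
  refine ENNReal.div_le_of_le_mul ?_
  have hc : ((Fintype.card (Fin n → Fin n) : ℕ) : ENNReal) = ENNReal.ofReal ((n : ℝ) ^ n) := by
    rw [Fintype.card_pi]
    simp [ENNReal.ofReal_pow]
  rw [hc, ← ENNReal.ofReal_mul (Real.exp_pos _).le, ← ENNReal.ofReal_natCast]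
  refine ENNReal.ofReal_le_ofReal ?_
  rw [Real.exp_sub, div_mul_eq_mul_div, le_div_iff₀ (Real.exp_pos _)]
  linarith

end Bootstrap

/-! ### Cells and their traces on the sample -/

section Cells

variable {d n : ℕ}

/-- A cell is the intersection of the root region with a product of intervals. -/
theorem SplitTree.exists_cell_eq_inter_pi (T : SplitTree d) (A : Set (Fin d → ℝ))
    (x : Fin d → ℝ) :
    ∃ I : Fin d → Set ℝ, (∀ i, (I i).OrdConnected) ∧ T.cell A x = A ∩ {u | ∀ i, u i ∈ I i} := by
  induction T generalizing A with
  | leaf => exact ⟨fun _ => Set.univ, fun _ => Set.ordConnected_univ, by simp [SplitTree.cell]⟩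
  | node i z l r hl hr =>
    have hord : ∀ (J I : Fin d → Set ℝ), (∀ j, (I j).OrdConnected) → (J i).OrdConnected →
        ∀ j, (I j ∩ {t | j = i → t ∈ J i}).OrdConnected := by
      intro J I hI hJ j
      refine (hI j).inter ?_
      by_cases hj : j = i
      · simpa [hj] using hJ
      · simpa [hj] using Set.ordConnected_univ
    rw [SplitTree.cell]
    split_ifs with hx
    · obtain ⟨I, hI, h⟩ := hl (A ∩ {u | u i < z})
      refine ⟨_, hord (fun _ => Set.Iio z) I hI Set.ordConnected_Iio, ?_⟩
      rw [h]
      ext u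
      simp only [Set.mem_inter_iff, Set.mem_ofPred_eq, Set.mem_Iio]
      constructor
      · rintro ⟨⟨hA, hz⟩, hu⟩
        exact ⟨hA, fun j => ⟨hu j, fun hj => hj ▸ hz⟩⟩
      · rintro ⟨hA, hu⟩
        exact ⟨⟨hA, (hu i).2 rfl⟩, fun j => (hu j).1⟩
    · obtain ⟨I, hI, h⟩ := hr (A ∩ {u | z ≤ u i})
      refine ⟨_, hord (fun _ => Set.Ici z) I hI Set.ordConnected_Ici, ?_⟩
      rw [h]
      ext u
      simp only [Set.mem_inter_iff, Set.mem_ofPred_eq, Set.mem_Ici]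
      constructor
      · rintro ⟨⟨hA, hz⟩, hu⟩
        exact ⟨hA, fun j => ⟨hu j, fun hj => hj ▸ hz⟩⟩
      · rintro ⟨hA, hu⟩
        exact ⟨⟨hA, (hu i).2 rfl⟩, fun j => (hu j).1⟩

/-- The box spanned by the sample points `X (a i)` and `X (c i)`, which bound coordinate `i` from
below and from above, intersected with the region `A`. -/
def sampleBox (A : Set (Fin d → ℝ)) (X : Fin n → Fin d → ℝ) (a c : Fin d → Fin n) :
    Set (Fin d → ℝ) :=
  A ∩ {u | ∀ i, X (a i) i ≤ u i ∧ u i ≤ X (c i) i}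

/-- Every cell that meets the sample has the same trace on it as one of the at most `n ^ (2 d)`
boxes that are spanned by sample points. -/
theorem exists_sampleBox_trace (A : Set (Fin d → ℝ)) {I : Fin d → Set ℝ}
    (hI : ∀ i, (I i).OrdConnected) (X : Fin n → Fin d → ℝ)
    (hne : ∃ j, X j ∈ A ∩ {u | ∀ i, u i ∈ I i}) :
    ∃ a c : Fin d → Fin n, ∀ j, X j ∈ A ∩ {u | ∀ i, u i ∈ I i} ↔ X j ∈ sampleBox A X a c := by
  classical
  set T : Finset (Fin n) := Finset.univ.filter fun j => X j ∈ A ∩ {u | ∀ i, u i ∈ I i} with hT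
  have hTne : T.Nonempty := by
    obtain ⟨j, hj⟩ := hne
    exact ⟨j, by simpa [hT] using hj⟩
  choose a haT ha using fun i => Finset.exists_min_image T (fun j => X j i) hTne
  choose c hcT hc using fun i => Finset.exists_max_image T (fun j => X j i) hTne
  have hmem : ∀ {j}, j ∈ T → X j ∈ A ∩ {u | ∀ i, u i ∈ I i} := fun hj => (Finset.mem_filter.1 hj).2
  refine ⟨a, c, fun j => ⟨fun hj => ⟨hj.1, fun i => ?_⟩, fun hj => ⟨hj.1, fun i => ?_⟩⟩⟩
  · have hjT : j ∈ T := by simpa [hT] using hj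
    exact ⟨ha i j hjT, hc i j hjT⟩
  · exact (hI i).out ((hmem (haT i)).2 i) ((hmem (hcT i)).2 i) (hj.2 i)

/-- The minimal leaf size passes from the cuts to the leaves. -/
theorem GrownByCART.le_card_indicesIn_cell {S : Sample d n} {m : ℕ}
    {J : List Bool → Finset (Fin d)} {T : SplitTree d} (x : Fin d → ℝ) :
    ∀ {v : List Bool} {A : Set (Fin d → ℝ)}, GrownByCART S m J v A T →
      m ≤ (indicesIn S A).card → m ≤ (indicesIn S (T.cell A x)).card := by
  induction T with
  | leaf => intro v A _ h; simpa [SplitTree.cell] using h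
  | node i z l r hl hr =>
    intro v A hg h
    rw [GrownByCART] at hg
    rw [SplitTree.cell]
    split_ifs
    · exact hl hg.2.1 hg.1.2.1.1
    · exact hr hg.2.2 hg.1.2.1.2

end Cells

/-! ### The estimator of a single tree -/

namespace BreimanRule

variable {d : ℕ} {𝒳 : Set (Fin d → ℝ)} (R : BreimanRule d 𝒳) {n : ℕ}

/-- Since `minLeaf` is at least one, no leaf is empty. -/
theorem leafCount_pos (x : Fin d → ℝ) (θ : TreeRandomness d) (D : Sample d n) (hn : 1 ≤ n)
    (hD : ∀ j, (D j).1 ∈ 𝒳) : 0 < R.leafCount x θ D := by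
  have hm := Finset.mem_Icc.1 (R.minLeaf_mem n hn)
  have hroot : indicesIn (bootstrapSample (θ.1 n) D) 𝒳 = Finset.univ := by
    ext i
    simp [indicesIn, bootstrapSample, hD]
  exact hm.1.trans ((R.grown n θ D).le_card_indicesIn_cell x (by rw [hroot]; simpa using hm.2))

theorem leafCount_le (x : Fin d → ℝ) (θ : TreeRandomness d) (D : Sample d n) :
    R.leafCount x θ D ≤ n := by
  simpa [leafCount] using Finset.card_le_univ
    (indicesIn (bootstrapSample (θ.1 n) D) (R.cell x θ D))

open Classical in
theorem leafCount_eq_sum (x : Fin d → ℝ) (θ : TreeRandomness d) (D : Sample d n) :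
    (R.leafCount x θ D : ℝ) =
      ∑ j, (drawCount (θ.1 n) j : ℝ) * (if (D j).1 ∈ R.cell x θ D then 1 else 0) := by
  rw [sum_drawCount_mul (θ.1 n) fun j => if (D j).1 ∈ R.cell x θ D then 1 else 0, leafCount,
    indicesIn, Finset.card_filter]
  push_cast
  rfl

open Classical in
/-- The estimator of the conditional distribution function that uses a single tree. It is zero if the
cell of `x` contains no bootstrap observation. -/
noncomputable def treeCdf (x : Fin d → ℝ) (y : ℝ) (θ : TreeRandomness d) (D : Sample d n) : ℝ :=
  (∑ j, (drawCount (θ.1 n) j : ℝ) * (if (D j).1 ∈ R.cell x θ D then 1 else 0) *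
    (if (D j).2 ≤ y then 1 else 0)) / R.leafCount x θ D

theorem cdfEstimator_eq_average (x : Fin d → ℝ) (k : ℕ) (θ : ℕ → TreeRandomness d)
    (D : Sample d n) (y : ℝ) :
    R.cdfEstimator x k θ D y = (1 / (k : ℝ)) * ∑ l ∈ Finset.range k, R.treeCdf x y (θ l) D := by
  classical
  simp only [cdfEstimator, weight, treeCdf]
  simp_rw [mul_assoc (1 / (k : ℝ))]
  rw [← Finset.mul_sum]
  congr 1
  simp_rw [Finset.sum_mul]
  rw [Finset.sum_comm]
  refine Finset.sum_congr rfl fun l _ => ?_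
  rw [Finset.sum_div]
  exact Finset.sum_congr rfl fun j _ => by rw [div_mul_eq_mul_div]

theorem treeCdf_nonneg (x : Fin d → ℝ) (y : ℝ) (θ : TreeRandomness d) (D : Sample d n) :
    0 ≤ R.treeCdf x y θ D := by
  unfold treeCdf
  positivity

theorem treeCdf_le_one (x : Fin d → ℝ) (y : ℝ) (θ : TreeRandomness d) (D : Sample d n) :
    R.treeCdf x y θ D ≤ 1 := by
  classical
  refine div_le_one_of_le₀ ?_ (by positivity)
  rw [leafCount_eq_sum]
  refine Finset.sum_le_sum fun j _ => mul_le_of_le_one_right (by positivity) ?_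
  split_ifs <;> norm_num

theorem treeCdf_mono (x : Fin d → ℝ) (θ : TreeRandomness d) (D : Sample d n) :
    Monotone fun y => R.treeCdf x y θ D := by
  classical
  intro y y' hy
  simp only [treeCdf]
  gcongr with j _
  split_ifs with h1 h2 <;> norm_num
  exact h2 (h1.trans hy)

open Classical in
theorem measurable_indicator_cell (x : Fin d → ℝ) (j : Fin n) :
    Measurable fun p : TreeRandomness d × Sample d n =>
      if (p.2 j).1 ∈ R.cell x p.1 p.2 then (1 : ℝ) else 0 :=
  Measurable.ite ((R.measurable_cell n x).preimage (by fun_prop :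
    Measurable fun p : TreeRandomness d × Sample d n => (p, (p.2 j).1)))
    measurable_const measurable_const

theorem measurable_drawCount (j : Fin n) :
    Measurable fun θ : TreeRandomness d => (drawCount (θ.1 n) j : ℝ) :=
  (measurable_of_finite fun b : Fin n → Fin n => (drawCount b j : ℝ)).comp
    (by fun_prop : Measurable fun θ : TreeRandomness d => θ.1 n)

theorem measurable_leafCount (x : Fin d → ℝ) :
    Measurable fun p : TreeRandomness d × Sample d n => (R.leafCount x p.1 p.2 : ℝ) := by
  simp_rw [leafCount_eq_sum]
  exact Finset.measurable_sum _ fun j _ =>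
    ((measurable_drawCount j).comp measurable_fst).mul (R.measurable_indicator_cell x j)

theorem measurable_treeCdf (x : Fin d → ℝ) (y : ℝ) :
    Measurable fun p : TreeRandomness d × Sample d n => R.treeCdf x y p.1 p.2 := by
  classical
  refine Measurable.div (Finset.measurable_sum _ fun j _ =>
    (((measurable_drawCount j).comp measurable_fst).mul (R.measurable_indicator_cell x j)).mul ?_)
    (R.measurable_leafCount x)
  exact Measurable.ite (measurableSet_le (by fun_prop) measurable_const)
    measurable_const measurable_const

end BreimanRule

/-! ### Uniform deviations of the bootstrap sums -/

section Deviation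

variable {d n : ℕ}

/-- The deviation of `1_{Y ≤ y}` from its conditional expectation. -/
noncomputable def cdfNoise (κ : Kernel (Fin d → ℝ) ℝ) (y : ℝ) (u : Fin d → ℝ) (v : ℝ) : ℝ :=
  (if v ≤ y then 1 else 0) - cdf (κ u) y

theorem measurable_cdf_kernel (κ : Kernel (Fin d → ℝ) ℝ) [IsMarkovKernel κ] (y : ℝ) :
    Measurable fun u => cdf (κ u) y := by
  simp_rw [cdf_eq_real, Measure.real]
  exact (κ.measurable_coe measurableSet_Iic).ennreal_toReal

theorem measurable_cdfNoise (κ : Kernel (Fin d → ℝ) ℝ) [IsMarkovKernel κ] (y : ℝ) :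
    Measurable (Function.uncurry (cdfNoise κ y)) :=
  (Measurable.ite (measurableSet_le measurable_snd measurable_const)
    measurable_const measurable_const).sub ((measurable_cdf_kernel κ y).comp measurable_fst)

theorem cdfNoise_mem_Icc (κ : Kernel (Fin d → ℝ) ℝ) (y : ℝ) (u : Fin d → ℝ) (v : ℝ) :
    cdfNoise κ y u v ∈ Set.Icc (-cdf (κ u) y) (-cdf (κ u) y + 1) := by
  rw [cdfNoise]
  split_ifs <;> constructor <;> linarith

theorem integral_cdfNoise (κ : Kernel (Fin d → ℝ) ℝ) [IsMarkovKernel κ] (y : ℝ) (u : Fin d → ℝ) :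
    ∫ v, cdfNoise κ y u v ∂κ u = 0 := by
  have h : (fun v : ℝ => if v ≤ y then (1 : ℝ) else 0) = (Set.Iic y).indicator 1 := by
    ext v
    simp [Set.indicator_apply]
  have hi : Integrable (fun v : ℝ => if v ≤ y then (1 : ℝ) else 0) (κ u) := by
    rw [h]
    exact (integrable_const (1 : ℝ)).indicator measurableSet_Iic
  simp only [cdfNoise]
  rw [integral_sub hi (integrable_const _), h, integral_indicator_one measurableSet_Iic,
    integral_const, cdf_eq_real]
  simp

open Classical in
/-- The bootstrap sum of the deviations `cdfNoise` over the region `A`. -/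
noncomputable def noiseSum (κ : Kernel (Fin d → ℝ) ℝ) (y : ℝ) (b : Fin n → Fin n)
    (D : Sample d n) (A : Set (Fin d → ℝ)) : ℝ :=
  ∑ j, (drawCount b j : ℝ) * (if (D j).1 ∈ A then 1 else 0) * cdfNoise κ y (D j).1 (D j).2

theorem measurableSet_mem_sampleBox {A : Set (Fin d → ℝ)} (hA : MeasurableSet A)
    (a c : Fin d → Fin n) (j : Fin n) :
    MeasurableSet {X : Fin n → Fin d → ℝ | X j ∈ sampleBox A X a c} := by
  have : {X : Fin n → Fin d → ℝ | X j ∈ sampleBox A X a c} =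
      (fun X => X j) ⁻¹' A ∩ ⋂ i, ({X | X (a i) i ≤ X j i} ∩ {X | X j i ≤ X (c i) i}) := by
    ext X
    simp [sampleBox]
  rw [this]
  refine (hA.preimage (measurable_pi_apply j)).inter (MeasurableSet.iInter fun i => ?_)
  exact (measurableSet_le (by fun_prop) (by fun_prop)).inter
    (measurableSet_le (by fun_prop) (by fun_prop))

theorem measurable_noiseSum_sampleBox (κ : Kernel (Fin d → ℝ) ℝ) [IsMarkovKernel κ] (y : ℝ)
    (b : Fin n → Fin n) {A : Set (Fin d → ℝ)} (hA : MeasurableSet A) (a c : Fin d → Fin n) :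
    Measurable fun D : Sample d n => noiseSum κ y b D (sampleBox A (fun j => (D j).1) a c) := by
  classical
  refine Finset.measurable_sum _ fun j _ => Measurable.mul (measurable_const.mul ?_) ?_
  · exact Measurable.ite ((measurableSet_mem_sampleBox hA a c j).preimage (by fun_prop :
      Measurable fun D : Sample d n => fun j => (D j).1)) measurable_const measurable_const
  · exact (measurable_cdfNoise κ y).comp (measurable_pi_apply j)

/-- Conditionally on the bootstrap draws, the deviation over a box spanned by sample points has
sub-Gaussian tails; if no index is drawn more than `m` times, then the variance proxy
`∑ j, B_j ^ 2` is at most `n * m`, since `∑ j, B_j = n`. -/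
theorem measure_pi_le_abs_noiseSum (ν : Measure (Fin d → ℝ)) [IsProbabilityMeasure ν]
    (κ : Kernel (Fin d → ℝ) ℝ) [IsMarkovKernel κ] (y : ℝ) (b : Fin n → Fin n)
    {A : Set (Fin d → ℝ)} (hA : MeasurableSet A) (a c : Fin d → Fin n) {m : ℝ} (hm : 0 < m)
    (hn : 0 < n) (hb : ∀ j, (drawCount b j : ℝ) ≤ m) {t : ℝ} (ht : 0 ≤ t) :
    Measure.pi (fun _ : Fin n => ν ⊗ₘ κ)
      {D | t ≤ |noiseSum κ y b D (sampleBox A (fun j => (D j).1) a c)|} ≤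
      2 * ENNReal.ofReal (Real.exp (-(t ^ 2 / (2 * (n * m))))) := by
  classical
  refine measure_pi_le_abs_weighted_sum ν κ (measurable_cdfNoise κ y) (fun u => -cdf (κ u) y)
    (cdfNoise_mem_Icc κ y) (integral_cdfNoise κ y)
    (fun j X => (drawCount b j : ℝ) * (if X j ∈ sampleBox A X a c then 1 else 0)) (fun j => ?_)
    (fun j => drawCount b j) (fun j X => ?_) (by positivity) ?_ ht
  · exact measurable_const.mul (Measurable.ite (measurableSet_mem_sampleBox hA a c j)
      measurable_const measurable_const)
  · split_ifs <;> simp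
  · have h : (∑ j, (drawCount b j : ℝ)) = n := by exact_mod_cast sum_drawCount b
    calc ∑ j, (drawCount b j : ℝ) ^ 2 ≤ ∑ j, (drawCount b j : ℝ) * m :=
          Finset.sum_le_sum fun j _ => by
            rw [sq]
            exact mul_le_mul_of_nonneg_left (hb j) (by positivity)
      _ = n * m := by rw [← Finset.sum_mul, h]

/-- The union bound over the draws, the indices, and the boxes spanned by sample points. -/
theorem measure_prod_exists_le_abs_noiseSum (ν : Measure (Fin d → ℝ)) [IsProbabilityMeasure ν]
    (κ : Kernel (Fin d → ℝ) ℝ) [IsMarkovKernel κ] (y : ℝ) {A : Set (Fin d → ℝ)}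
    (hA : MeasurableSet A) {m : ℝ} (hm : 0 < m) (hn : 0 < n) {t : ℝ} (ht : 0 ≤ t) :
    ((uniformOn Set.univ : Measure (Fin n → Fin n)).prod (Measure.pi fun _ : Fin n => ν ⊗ₘ κ))
      {p | ∃ a c, t ≤ |noiseSum κ y p.1 p.2 (sampleBox A (fun j => (p.2 j).1) a c)|} ≤
      n * ENNReal.ofReal (Real.exp (2 - m)) +
        (n ^ d * n ^ d : ℕ) * (2 * ENNReal.ofReal (Real.exp (-(t ^ 2 / (2 * (n * m)))))) := by
  classical
  have : Nonempty (Fin n) := ⟨⟨0, hn⟩⟩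
  have hP : IsProbabilityMeasure (uniformOn Set.univ : Measure (Fin n → Fin n)) :=
    isProbabilityMeasure_uniformOn Set.finite_univ Set.univ_nonempty
  set P := (uniformOn Set.univ : Measure (Fin n → Fin n)).prod
    (Measure.pi fun _ : Fin n => ν ⊗ₘ κ) with hPdef
  set U : Fin n → Set ((Fin n → Fin n) × Sample d n) := fun j =>
    {b : Fin n → Fin n | m ≤ drawCount b j} ×ˢ Set.univ with hU
  set W : (Fin d → Fin n) × (Fin d → Fin n) → Set ((Fin n → Fin n) × Sample d n) := fun q =>
    {p | (∀ j, (drawCount p.1 j : ℝ) ≤ m) ∧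
      t ≤ |noiseSum κ y p.1 p.2 (sampleBox A (fun j => (p.2 j).1) q.1 q.2)|} with hW
  -- either some index is drawn at least `m` times, or the sub-Gaussian bound with `n * m` applies
  have hcover : {p : (Fin n → Fin n) × Sample d n | ∃ a c,
      t ≤ |noiseSum κ y p.1 p.2 (sampleBox A (fun j => (p.2 j).1) a c)|} ⊆
      (⋃ j, U j) ∪ ⋃ q, W q := by
    rintro p ⟨a, c, h⟩
    by_cases hp : ∀ j, (drawCount p.1 j : ℝ) ≤ m
    · exact Or.inr (Set.mem_iUnion.2 ⟨(a, c), hp, h⟩)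
    · push Not at hp
      obtain ⟨j, hj⟩ := hp
      exact Or.inl (Set.mem_iUnion.2 ⟨j, hj.le, trivial⟩)
  have hUle : ∀ j, P (U j) ≤ ENNReal.ofReal (Real.exp (2 - m)) := by
    intro j
    rw [hPdef, Measure.prod_prod, measure_univ, mul_one]
    exact uniformOn_le_drawCount j m
  have hWle : ∀ q, P (W q) ≤ 2 * ENNReal.ofReal (Real.exp (-(t ^ 2 / (2 * (n * m))))) := by
    intro q
    have hWm : MeasurableSet (W q) := by
      refine MeasurableSet.inter ?_ ?_
      · exact measurable_fst (Set.toFinite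
          {b : Fin n → Fin n | ∀ j, (drawCount b j : ℝ) ≤ m}).measurableSet
      · have hmeas : Measurable fun p : (Fin n → Fin n) × Sample d n =>
            noiseSum κ y p.1 p.2 (sampleBox A (fun j => (p.2 j).1) q.1 q.2) :=
          measurable_from_prod_countable_right fun b =>
            measurable_noiseSum_sampleBox κ y b hA q.1 q.2
        exact measurableSet_le measurable_const hmeas.norm
    rw [hPdef, Measure.prod_apply hWm]
    refine (lintegral_mono (g := fun _ => 2 * ENNReal.ofReal (Real.exp (-(t ^ 2 / (2 * (n * m))))))
      fun b => ?_).trans (by simp)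
    by_cases hb : ∀ j, (drawCount b j : ℝ) ≤ m
    · exact (measure_mono fun D hD => hD.2).trans
        (measure_pi_le_abs_noiseSum ν κ y b hA q.1 q.2 hm hn hb ht)
    · have : Prod.mk b ⁻¹' W q = ∅ := by
        ext D
        simp only [hW, Set.mem_preimage, Set.mem_ofPred_eq, Set.mem_empty_iff_false, iff_false]
        exact fun h => hb h.1
      rw [this]
      simp
  refine (measure_mono hcover).trans ((measure_union_le _ _).trans (add_le_add ?_ ?_))
  · refine (measure_iUnion_fintype_le P U).trans ((Finset.sum_le_sum fun j _ => hUle j).trans ?_)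
    simp
  · refine (measure_iUnion_fintype_le P W).trans ((Finset.sum_le_sum fun q _ => hWle q).trans ?_)
    simp [Finset.card_univ]

end Deviation

/-- The union bound is summable when the threshold is a large multiple of `√n * log n`: since the
multiplicities are at most `3 * log n` with high probability, the exponent is of order `log n`. -/
theorem ae_eventually_abs_noiseSum_lt {Ω : Type*} [MeasurableSpace Ω] {μ : Measure Ω}
    [IsProbabilityMeasure μ] {d : ℕ} (ν : Measure (Fin d → ℝ)) [IsProbabilityMeasure ν]
    (κ : Kernel (Fin d → ℝ) ℝ) [IsMarkovKernel κ] (y : ℝ) {A : Set (Fin d → ℝ)}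
    (hA : MeasurableSet A) (Z : ℕ → Ω → Obs d) (hZm : ∀ j, Measurable (Z j)) (hZi : iIndepFun Z μ)
    (hZν : ∀ j, μ.map (Z j) = ν ⊗ₘ κ) (Θ : Ω → TreeRandomness d) (hΘm : Measurable Θ)
    (hΘZ : IndepFun Θ (fun ω j => Z j ω) μ)
    (hboot : ∀ n, μ.map (fun ω => (Θ ω).1 n) = uniformOn Set.univ) :
    ∀ᵐ ω ∂μ, ∀ᶠ n : ℕ in atTop, ∀ a c : Fin d → Fin n,
      |noiseSum κ y ((Θ ω).1 n) (firstObs Z n ω)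
        (sampleBox A (fun j => (firstObs Z n ω j).1) a c)| <
        Real.sqrt (12 * (d + 1)) * (Real.sqrt n * Real.log n) := by
  have hfo : ∀ n, Measurable (firstObs Z n) := fun n => measurable_pi_lambda _ fun j => hZm j
  have hlaw : ∀ n, μ.map (fun ω => ((Θ ω).1 n, firstObs Z n ω)) =
      (uniformOn Set.univ : Measure (Fin n → Fin n)).prod
        (Measure.pi fun _ : Fin n => ν ⊗ₘ κ) := by
    intro n
    have hbm : Measurable fun ω => (Θ ω).1 n :=
      (by fun_prop : Measurable fun θ : TreeRandomness d => θ.1 n).comp hΘm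
    have hind : IndepFun (fun ω => (Θ ω).1 n) (firstObs Z n) μ :=
      hΘZ.comp (by fun_prop : Measurable fun θ : TreeRandomness d => θ.1 n)
        (by fun_prop : Measurable fun (z : ℕ → Obs d) (j : Fin n) => z j)
    have hpi : μ.map (firstObs Z n) = Measure.pi fun _ : Fin n => ν ⊗ₘ κ := by
      have h := (iIndepFun_iff_map_fun_eq_pi_map (μ := μ)
        (f := fun (j : Fin n) => Z j) fun j => (hZm j).aemeasurable).1
        (hZi.precomp Fin.val_injective)
      simp_rw [hZν] at h
      exact h
    rw [(indepFun_iff_map_prod_eq_prod_map_map hbm.aemeasurable (hfo n).aemeasurable).1 hind,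
      hboot n, hpi]
  set s : ℕ → Set Ω := fun n => {ω | 2 ≤ n ∧ ∃ a c : Fin d → Fin n,
    Real.sqrt (12 * (d + 1)) * (Real.sqrt n * Real.log n) ≤
      |noiseSum κ y ((Θ ω).1 n) (firstObs Z n ω)
        (sampleBox A (fun j => (firstObs Z n ω j).1) a c)|} with hs
  have hle : ∀ n, μ (s n) ≤ ENNReal.ofReal ((Real.exp 2 + 2) * (1 / (n : ℝ) ^ 2)) := by
    intro n
    rcases lt_or_ge n 2 with hn | hn
    · have : s n = ∅ := by
        ext ω
        simp only [hs, Set.mem_ofPred_eq, Set.mem_empty_iff_false, iff_false]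
        omega
      simp [this]
    have hn0 : (0 : ℝ) < n := by positivity
    have hlog : 0 < Real.log n := Real.log_pos (by exact_mod_cast hn)
    have hbm : AEMeasurable (fun ω => ((Θ ω).1 n, firstObs Z n ω)) μ :=
      (((by fun_prop : Measurable fun θ : TreeRandomness d => θ.1 n).comp hΘm).prodMk
        (hfo n)).aemeasurable
    have hbd := measure_prod_exists_le_abs_noiseSum (n := n) ν κ y hA (m := 3 * Real.log n)
      (by positivity) (by omega)
      (t := Real.sqrt (12 * (d + 1)) * (Real.sqrt n * Real.log n)) (by positivity)
    rw [← hlaw n] at hbd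
    refine ((measure_mono fun ω hω => hω.2).trans
      ((Measure.le_map_apply hbm _).trans hbd)).trans ?_
    have e1 : Real.exp (2 - 3 * Real.log n) = Real.exp 2 / (n : ℝ) ^ 3 := by
      rw [Real.exp_sub, mul_comm, Real.exp_mul, Real.exp_log hn0]
      norm_cast
    have e2 : Real.exp (-((Real.sqrt (12 * (d + 1)) * (Real.sqrt n * Real.log n)) ^ 2 /
        (2 * (n * (3 * Real.log n))))) = 1 / (n : ℝ) ^ (2 * d + 2) := by
      rw [mul_pow, mul_pow, Real.sq_sqrt (by positivity), Real.sq_sqrt (by positivity)]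
      rw [show 12 * ((d : ℝ) + 1) * (n * Real.log n ^ 2) / (2 * (n * (3 * Real.log n))) =
        Real.log n * (2 * d + 2 : ℕ) by push_cast; field_simp; ring]
      rw [Real.exp_neg, Real.exp_mul, Real.exp_log hn0, Real.rpow_natCast, one_div]
    -- the exponent `2 d + 2` absorbs the number `n ^ (2 d)` of boxes and leaves `1 / n ^ 2`
    rw [e1, e2, ← ENNReal.ofReal_natCast, ← ENNReal.ofReal_natCast,
      show (2 : ENNReal) = ENNReal.ofReal 2 by simp, ← ENNReal.ofReal_mul (by positivity),
      ← ENNReal.ofReal_mul (by positivity), ← ENNReal.ofReal_mul (by positivity),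
      ← ENNReal.ofReal_add (by positivity) (by positivity)]
    refine ENNReal.ofReal_le_ofReal (le_of_eq ?_)
    push_cast
    field_simp
    ring
  have hsum : ∑' n, μ (s n) ≠ ⊤ := by
    have hsm : Summable fun n : ℕ => (Real.exp 2 + 2) * (1 / (n : ℝ) ^ 2) :=
      (Real.summable_one_div_nat_pow.2 one_lt_two).mul_left _
    refine ne_top_of_le_ne_top hsm.tsum_ofReal_ne_top (ENNReal.tsum_le_tsum hle)
  filter_upwards [ae_eventually_notMem hsum] with ω hω
  filter_upwards [hω, eventually_ge_atTop 2] with n hn hn2 a c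
  by_contra hcon
  exact hn ⟨hn2, a, c, not_lt.1 hcon⟩

/-! ### Consistency of a single tree -/

section Tree

variable {d : ℕ} {𝒳 : Set (Fin d → ℝ)}

theorem abs_cdf_sub_cdf_le_one (P Q : Measure ℝ) (y : ℝ) : |cdf P y - cdf Q y| ≤ 1 :=
  abs_le.2 ⟨by linarith [cdf_nonneg P y, cdf_le_one Q y],
    by linarith [cdf_nonneg Q y, cdf_le_one P y]⟩

namespace BreimanRule

variable (R : BreimanRule d 𝒳) {n : ℕ}

/-- The error of a tree is at most its noise plus the oscillation of the conditional distribution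
function over the cell. -/
theorem abs_treeCdf_sub_cdf_le (κ : Kernel (Fin d → ℝ) ℝ) (x : Fin d → ℝ) (y : ℝ)
    (θ : TreeRandomness d) (D : Sample d n) (hN : 0 < R.leafCount x θ D) :
    |R.treeCdf x y θ D - cdf (κ x) y| ≤
      |noiseSum κ y (θ.1 n) D (R.cell x θ D)| / R.leafCount x θ D +
        ⨆ z : R.cell x θ D, |cdf (κ z) y - cdf (κ x) y| := by
  classical
  set S := ⨆ z : R.cell x θ D, |cdf (κ z) y - cdf (κ x) y| with hS
  have hN' : (0 : ℝ) < R.leafCount x θ D := by exact_mod_cast hN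
  have hbdd : BddAbove (Set.range fun z : R.cell x θ D => |cdf (κ z) y - cdf (κ x) y|) :=
    ⟨1, by rintro _ ⟨z, rfl⟩; exact abs_cdf_sub_cdf_le_one _ _ _⟩
  have hsplit : R.treeCdf x y θ D - cdf (κ x) y =
      noiseSum κ y (θ.1 n) D (R.cell x θ D) / R.leafCount x θ D +
      (∑ j, (drawCount (θ.1 n) j : ℝ) * (if (D j).1 ∈ R.cell x θ D then 1 else 0) *
        (cdf (κ (D j).1) y - cdf (κ x) y)) / R.leafCount x θ D := by
    rw [← add_div, treeCdf, eq_div_iff hN'.ne', sub_mul, div_mul_cancel₀ _ hN'.ne']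
    nth_rw 1 [leafCount_eq_sum]
    rw [noiseSum, ← Finset.sum_add_distrib, Finset.mul_sum, ← Finset.sum_sub_distrib]
    refine Finset.sum_congr rfl fun j _ => ?_
    rw [cdfNoise]
    ring
  rw [hsplit]
  refine (abs_add_le _ _).trans (add_le_add ?_ ?_)
  · rw [abs_div, abs_of_pos hN']
  · rw [abs_div, abs_of_pos hN', div_le_iff₀ hN', leafCount_eq_sum, Finset.mul_sum]
    refine (Finset.abs_sum_le_sum_abs _ _).trans (Finset.sum_le_sum fun j _ => ?_)
    by_cases hj : (D j).1 ∈ R.cell x θ D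
    · rw [if_pos hj, mul_one, abs_mul, Nat.abs_cast, mul_comm]
      gcongr
      exact le_ciSup hbdd ⟨_, hj⟩
    · simp [hj]

/-- The noise of a nonempty cell is the noise of one of the boxes spanned by sample points. -/
theorem exists_noiseSum_cell_eq (κ : Kernel (Fin d → ℝ) ℝ) (x : Fin d → ℝ) (y : ℝ)
    (θ : TreeRandomness d) (D : Sample d n) (hN : 0 < R.leafCount x θ D) :
    ∃ a c, noiseSum κ y (θ.1 n) D (R.cell x θ D) =
      noiseSum κ y (θ.1 n) D (sampleBox 𝒳 (fun j => (D j).1) a c) := by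
  classical
  obtain ⟨I, hI, hcell⟩ := (R.tree n θ D).exists_cell_eq_inter_pi 𝒳 x
  obtain ⟨i, hi⟩ := Finset.card_pos.1 hN
  have hne : ∃ j, (D j).1 ∈ 𝒳 ∩ {u | ∀ i, u i ∈ I i} := by
    refine ⟨θ.1 n i, ?_⟩
    rw [← hcell]
    exact (Finset.mem_filter.1 hi).2
  obtain ⟨a, c, h⟩ := exists_sampleBox_trace 𝒳 hI (fun j => (D j).1) hne
  refine ⟨a, c, Finset.sum_congr rfl fun j _ => ?_⟩
  rw [cell, hcell]
  simp only [h j]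

/-- Consistency of a single tree at the level `y`: the noise is `O(√n * log n)`, whereas the leaf
counts are at least of order `√n * (log n) ^ β` with `β > 1`. -/
theorem ae_tendsto_treeCdf {Ω : Type*} [MeasurableSpace Ω] {μ : Measure Ω}
    [IsProbabilityMeasure μ] (h𝒳 : MeasurableSet 𝒳) (ν : Measure (Fin d → ℝ))
    [IsProbabilityMeasure ν] (κ : Kernel (Fin d → ℝ) ℝ) [IsMarkovKernel κ]
    (Z : ℕ → Ω → Obs d) (hZm : ∀ j, Measurable (Z j)) (hZi : iIndepFun Z μ)
    (hZν : ∀ j, μ.map (Z j) = ν ⊗ₘ κ) (hZ𝒳 : ∀ᵐ ω ∂μ, ∀ j, (Z j ω).1 ∈ 𝒳)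
    (Θ : Ω → TreeRandomness d) (hΘm : Measurable Θ) (hΘZ : IndepFun Θ (fun ω j => Z j ω) μ)
    (hboot : ∀ n, μ.map (fun ω => (Θ ω).1 n) = uniformOn Set.univ) (x : Fin d → ℝ) (y : ℝ)
    (hosc : ∀ᵐ ω ∂μ, Tendsto (fun n => ⨆ z : R.cell x (Θ ω) (firstObs Z n ω),
      |cdf (κ z) y - cdf (κ x) y|) atTop (𝓝 0))
    {β : ℝ} (hβ : 1 < β) (hleaf : ∀ᵐ ω ∂μ,
      IsBigOmega (fun n => (R.leafCount x (Θ ω) (firstObs Z n ω) : ℝ))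
        (fun n => Real.sqrt n * Real.log n ^ β)) :
    ∀ᵐ ω ∂μ, Tendsto (fun n => |R.treeCdf x y (Θ ω) (firstObs Z n ω) - cdf (κ x) y|)
      atTop (𝓝 0) := by
  filter_upwards [ae_eventually_abs_noiseSum_lt ν κ y h𝒳 Z hZm hZi hZν Θ hΘm hΘZ hboot, hZ𝒳, hosc,
    hleaf] with ω hnoise hω hoscω hleafω
  obtain ⟨c, hc, n₀, -, hcn⟩ := hleafω
  have hlog : Tendsto (fun n : ℕ => Real.log n) atTop atTop :=
    Real.tendsto_log_atTop.comp tendsto_natCast_atTop_atTop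
  have hrate : Tendsto (fun n : ℕ => Real.sqrt (12 * (d + 1)) / c * Real.log n ^ (-(β - 1)))
      atTop (𝓝 0) := by
    simpa using ((tendsto_rpow_neg_atTop (sub_pos.2 hβ)).comp hlog).const_mul
      (Real.sqrt (12 * (d + 1)) / c)
  have hbound := hrate.add hoscω
  rw [add_zero] at hbound
  refine squeeze_zero' (Eventually.of_forall fun n => abs_nonneg _) ?_ hbound
  filter_upwards [hnoise, eventually_ge_atTop 2, eventually_ge_atTop n₀] with n hn hn2 hnn₀
  have hN := R.leafCount_pos x (Θ ω) (firstObs Z n ω) (by omega) fun j => hω j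
  refine (R.abs_treeCdf_sub_cdf_le κ x y _ _ hN).trans (add_le_add ?_ le_rfl)
  obtain ⟨a, c', h⟩ := R.exists_noiseSum_cell_eq κ x y _ _ hN
  have hl : 0 < Real.log n := Real.log_pos (by exact_mod_cast hn2)
  have hn0 : (0 : ℝ) < n := by positivity
  have hlow := hcn n hnn₀
  rw [Nat.abs_cast, abs_of_pos (by positivity)] at hlow
  rw [h, div_le_iff₀ (by exact_mod_cast hN)]
  refine (hn a c').le.trans ?_
  calc Real.sqrt (12 * (d + 1)) * (Real.sqrt n * Real.log n)
      = Real.sqrt (12 * (d + 1)) / c * Real.log n ^ (-(β - 1)) *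
        (c * (Real.sqrt n * Real.log n ^ β)) := by
        have : Real.log n ^ (-(β - 1)) * Real.log n ^ β = Real.log n := by
          rw [← Real.rpow_add hl]
          simp
        nth_rw 1 [← this]
        field_simp
    _ ≤ _ := mul_le_mul_of_nonneg_left hlow (by positivity)

end BreimanRule

end Tree

/-! ### Leaf counts with small coefficient of variation -/

/-- The Bertrand series, by Cauchy condensation. -/
theorem summable_one_div_nat_mul_log_rpow {γ : ℝ} (hγ : 1 < γ) :
    Summable fun n : ℕ => 1 / ((n : ℝ) * Real.log n ^ γ) := by
  rw [← summable_condensed_iff_of_eventually_nonneg]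
  · have h : (fun k : ℕ => (2 : ℝ) ^ k * (1 / (((2 ^ k : ℕ) : ℝ) * Real.log (2 ^ k : ℕ) ^ γ))) =
        fun k : ℕ => (1 / Real.log 2 ^ γ) * (1 / (k : ℝ) ^ γ) := by
      funext k
      have h2 : (0 : ℝ) ≤ Real.log 2 := Real.log_nonneg one_le_two
      push_cast
      rw [Real.log_pow, Real.mul_rpow (by positivity) h2]
      field_simp
    rw [h]
    exact (Real.summable_one_div_nat_rpow.2 hγ).mul_left _
  · filter_upwards [eventually_ge_atTop 2] with n hn
    have : 0 < Real.log n := Real.log_pos (by exact_mod_cast hn)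
    simp only [Pi.zero_apply]
    positivity
  · filter_upwards [eventually_ge_atTop 2] with n hn
    have : 0 < Real.log n := Real.log_pos (by exact_mod_cast hn)
    have hn0 : (0 : ℝ) < n := by positivity
    have : Real.log n ≤ Real.log (n + 1 : ℕ) := Real.log_le_log hn0 (by push_cast; linarith)
    gcongr
    linarith

/-- By Chebyshev's inequality and the Borel–Cantelli lemma, random variables whose coefficients of
variation are `O(1 / (√n * (log n) ^ (γ / 2)))` with `γ > 1` are eventually at least half of their
expectations. -/
theorem ae_isBigOmega_of_coeffVar {Ω : Type*} [MeasurableSpace Ω] {μ : Measure Ω}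
    [IsProbabilityMeasure μ] {X : ℕ → Ω → ℝ} (hX : ∀ n, MemLp (X n) 2 μ)
    (hE : ∀ᶠ n in atTop, 0 < ∫ ω, X n ω ∂μ) {g : ℕ → ℝ}
    (hg : IsBigOmega (fun n => ∫ ω, X n ω ∂μ) g) {γ : ℝ} (hγ : 1 < γ)
    (hcv : (fun n => coeffVar (X n) μ) =O[atTop]
      fun n : ℕ => 1 / (Real.sqrt n * Real.log n ^ (γ / 2))) :
    ∀ᵐ ω ∂μ, IsBigOmega (fun n => X n ω) g := by
  obtain ⟨C, hC⟩ := hcv.bound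
  obtain ⟨n₁, hn₁⟩ := eventually_atTop.1 (hC.and (hE.and (eventually_ge_atTop 2)))
  set s : ℕ → Set Ω := fun n =>
    {ω | n₁ ≤ n ∧ (∫ ω, X n ω ∂μ) / 2 ≤ |X n ω - ∫ ω, X n ω ∂μ|} with hs
  have hle : ∀ n, μ (s n) ≤ ENNReal.ofReal (4 * C ^ 2 * (1 / ((n : ℝ) * Real.log n ^ γ))) := by
    intro n
    by_cases hn : n₁ ≤ n
    · obtain ⟨h1, h2, h3⟩ := hn₁ n hn
      refine ((measure_mono fun ω hω => hω.2).trans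
        (meas_ge_le_variance_div_sq (hX n) (half_pos h2))).trans (ENNReal.ofReal_le_ofReal ?_)
      have hl : 0 < Real.log n := Real.log_pos (by exact_mod_cast h3)
      have hvar : variance (X n) μ / ((∫ ω, X n ω ∂μ) / 2) ^ 2 = 4 * coeffVar (X n) μ ^ 2 := by
        rw [coeffVar, div_pow, div_pow, Real.sq_sqrt (variance_nonneg _ _)]
        field_simp
        norm_num
      have hsq : (1 / (Real.sqrt n * Real.log n ^ (γ / 2))) ^ 2 =
          1 / ((n : ℝ) * Real.log n ^ γ) := by
        rw [div_pow, mul_pow, Real.sq_sqrt (by positivity), ← Real.rpow_mul_natCast hl.le]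
        norm_num
      rw [hvar, mul_assoc, ← hsq, ← mul_pow, ← sq_abs (coeffVar _ _), ← Real.norm_eq_abs]
      rw [Real.norm_of_nonneg (show (0 : ℝ) ≤ 1 / (Real.sqrt n * Real.log n ^ (γ / 2)) by
        positivity)] at h1
      gcongr
    · have : s n = ∅ := by
        ext ω
        simp [hs, hn]
      simp [this]
  have hsum : ∑' n, μ (s n) ≠ ⊤ := by
    have hsm := (summable_one_div_nat_mul_log_rpow hγ).mul_left (4 * C ^ 2)
    exact ne_top_of_le_ne_top hsm.tsum_ofReal_ne_top (ENNReal.tsum_le_tsum hle)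
  obtain ⟨c, hc, n₀, -, hcn⟩ := hg
  filter_upwards [ae_eventually_notMem hsum] with ω hω
  obtain ⟨n₂, hn₂⟩ := eventually_atTop.1 hω
  refine ⟨c / 2, by positivity, n₀ + n₁ + n₂ + 1, by omega, fun n hn => ?_⟩
  have h1 := hcn n (by omega)
  have h2 := (hn₁ n (by omega)).2.1
  have h3 : |X n ω - ∫ ω, X n ω ∂μ| < (∫ ω, X n ω ∂μ) / 2 := by
    by_contra hcon
    exact hn₂ n (by omega) ⟨by omega, not_lt.1 hcon⟩
  rw [abs_of_pos h2] at h1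
  rw [abs_lt] at h3
  have := le_abs_self (X n ω)
  linarith

/-! ### Consistency of the forest -/

theorem mainTheorem1 {Ω : Type*} [MeasurableSpace Ω] (μ : Measure Ω) [IsProbabilityMeasure μ]
    (d : ℕ) (𝒳 : Set (Fin d → ℝ)) (h𝒳 : MeasurableSet 𝒳)
    -- the law of `(X, Y)`, with `X ∈ 𝒳`, and a version `κ x` of the law of `Y` given `X = x`
    (ρ : Measure (Obs d)) [IsProbabilityMeasure ρ] (hρ : ∀ᵐ p ∂ρ, p.1 ∈ 𝒳)
    (κ : Kernel (Fin d → ℝ) ℝ) [IsMarkovKernel κ] (hκ : ρ.fst ⊗ₘ κ = ρ)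
    -- the training sample: independent, distributed as `(X, Y)`
    (Z : ℕ → Ω → Obs d) (hZm : ∀ j, Measurable (Z j)) (hZi : iIndepFun Z μ)
    (hZρ : ∀ j, μ.map (Z j) = ρ)
    -- the forest: a tree-growing rule, the random elements `Θ_1, Θ_2, …`, and the number of trees
    (R : BreimanRule d 𝒳)
    (Θ : ℕ → Ω → TreeRandomness d) (hΘm : ∀ l, Measurable (Θ l)) (hΘi : iIndepFun Θ μ)
    (hΘd : ∀ l, IdentDistrib (Θ l) (Θ 0) μ μ)
    (hΘZ : IndepFun (fun ω l => Θ l ω) (fun ω j => Z j ω) μ)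
    -- bootstrap draws are uniform with replacement, split directions uniform without replacement
    (hboot : ∀ l n, μ.map (fun ω => (Θ l ω).1 n) = uniformOn Set.univ)
    (hfeat : ∀ l n v, μ.map (fun ω => (Θ l ω).2 n v) =
      uniformOn {J : Finset (Fin d) | J.card = R.maxFeatures n})
    (k : ℕ → ℕ) (hk : ∀ n, 1 ≤ k n)
    -- the variation of the conditional CDF within any cell goes to zero
    (hyp1 : ∀ l, ∀ x ∈ 𝒳, ∀ y : ℝ, ∀ᵐ ω ∂μ,
      Tendsto (fun n => ⨆ z : R.cell x (Θ l ω) (firstObs Z n ω), |cdf (κ z) y - cdf (κ x) y|)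
        atTop (𝓝 0))
    -- the number of trees, and the number of bootstrap observations in the leaves
    (α : ℝ) (hα : 0 < α)
    (hyp2_1 : (fun n => (k n : ℝ)) =O[atTop] fun n : ℕ => (n : ℝ) ^ α)
    (β : ℝ) (hβ : 1 < β) (γ : ℝ) (hγ : 1 < γ)
    (hyp2_2_or_3 :
      (∀ x ∈ 𝒳, ∀ l, ∀ᵐ ω ∂μ,
        IsBigOmega (fun n => (R.leafCount x (Θ l ω) (firstObs Z n ω) : ℝ))
          (fun n => Real.sqrt n * Real.log n ^ β)) ∨
      ((∀ x ∈ 𝒳, ∀ l,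
        IsBigOmega (fun n => ∫ ω, (R.leafCount x (Θ l ω) (firstObs Z n ω) : ℝ) ∂μ)
          (fun n => Real.sqrt n * Real.log n ^ β)) ∧
       (∀ x ∈ 𝒳, ∀ l,
        (fun n => coeffVar (fun ω => (R.leafCount x (Θ l ω) (firstObs Z n ω) : ℝ)) μ) =O[atTop]
          fun n : ℕ => 1 / (Real.sqrt n * Real.log n ^ (γ / 2)))))
    -- the conditional CDFs are continuous and strictly increasing
    (hyp3 : ∀ x ∈ 𝒳, Continuous (fun y => cdf (κ x) y) ∧ StrictMono (fun y => cdf (κ x) y)) :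
    ∀ x ∈ 𝒳, ∀ᵐ ω ∂μ,
      Tendsto (fun n => ⨆ y : ℝ,
          |R.cdfEstimator x (k n) (fun l => Θ l ω) (firstObs Z n ω) y - cdf (κ x) y|)
        atTop (𝓝 0) := by
  intro x hx
  have hZ𝒳 : ∀ᵐ ω ∂μ, ∀ j, (Z j ω).1 ∈ 𝒳 := ae_all_iff.2 fun j =>
    ae_of_ae_map (hZm j).aemeasurable (p := fun p => p.1 ∈ 𝒳) (by rw [hZρ j]; exact hρ)
  have hZ' : Measurable fun ω j => Z j ω := measurable_pi_lambda _ hZm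
  have hfo : ∀ n, Measurable (firstObs Z n) := fun n => measurable_pi_lambda _ fun j => hZm j
  have hΘZl : ∀ l, IndepFun (Θ l) (fun ω j => Z j ω) μ := fun l =>
    hΘZ.comp (measurable_pi_apply l) measurable_id
  have hleaf : ∀ l, ∀ᵐ ω ∂μ,
      IsBigOmega (fun n => (R.leafCount x (Θ l ω) (firstObs Z n ω) : ℝ))
        (fun n => Real.sqrt n * Real.log n ^ β) := by
    intro l
    rcases hyp2_2_or_3 with h | ⟨hE, hcv⟩
    · exact h x hx l
    · have hmem : ∀ (n : ℕ) (p : ENNReal),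
          MemLp (fun ω => (R.leafCount x (Θ l ω) (firstObs Z n ω) : ℝ)) p μ := fun n p =>
        (memLp_top_of_bound ((R.measurable_leafCount x).comp
          ((hΘm l).prodMk (hfo n))).aestronglyMeasurable (n : ℝ) (Eventually.of_forall fun ω => by
            rw [Function.comp_apply, Real.norm_natCast]
            exact_mod_cast R.leafCount_le x _ _)).mono_exponent le_top
      refine ae_isBigOmega_of_coeffVar (fun n => hmem n 2) ?_ (hE x hx l) hγ (hcv x hx l)
      filter_upwards [eventually_ge_atTop 1] with n hn
      have h1 : ∫ _, (1 : ℝ) ∂μ ≤ ∫ ω, (R.leafCount x (Θ l ω) (firstObs Z n ω) : ℝ) ∂μ := by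
        refine integral_mono_ae (integrable_const _) (memLp_one_iff_integrable.1 (hmem n 1)) ?_
        filter_upwards [hZ𝒳] with ω hω
        exact_mod_cast R.leafCount_pos x (Θ l ω) (firstObs Z n ω) hn fun j => hω j
      simp only [integral_const, probReal_univ, smul_eq_mul, mul_one] at h1
      linarith
  -- consistency at a fixed level `y`
  have hpoint : ∀ y : ℝ, ∀ᵐ ω ∂μ,
      Tendsto (fun n => R.cdfEstimator x (k n) (fun l => Θ l ω) (firstObs Z n ω) y) atTop
        (𝓝 (cdf (κ x) y)) := by
    intro y
    have hF : cdf (κ x) y ∈ Set.Icc (0 : ℝ) 1 := ⟨cdf_nonneg _ _, cdf_le_one _ _⟩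
    have havg := ae_tendsto_average_of_iid_of_indep (μ := μ)
      (g := fun n (p : TreeRandomness d × (ℕ → Obs d)) =>
        |R.treeCdf x y p.1 (fun j : Fin n => p.2 j) - cdf (κ x) y|)
      (fun n => (((R.measurable_treeCdf x y).comp (by fun_prop :
        Measurable fun p : TreeRandomness d × (ℕ → Obs d) =>
          (p.1, fun j : Fin n => p.2 j))).sub_const _).norm)
      (fun n p => abs_nonneg _)
      (fun n p => abs_le.2
        ⟨by linarith [hF.2, R.treeCdf_nonneg x y p.1 fun j : Fin n => p.2 j],
          by linarith [hF.1, R.treeCdf_le_one x y p.1 fun j : Fin n => p.2 j]⟩)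
      hΘm hΘi hΘd hZ' hΘZ k
      (fun l => R.ae_tendsto_treeCdf h𝒳 ρ.fst κ Z hZm hZi (fun j => by rw [hZρ j, hκ]) hZ𝒳
        (Θ l) (hΘm l) (hΘZl l) (hboot l) x y (hyp1 l x hx y) hβ (hleaf l))
    filter_upwards [havg] with ω hω
    rw [tendsto_iff_norm_sub_tendsto_zero]
    refine squeeze_zero (fun n => norm_nonneg _) (fun n => ?_) hω
    have hk0 : (k n : ℝ) ≠ 0 := Nat.cast_ne_zero.2 (by have := hk n; omega)
    have hsplit : R.cdfEstimator x (k n) (fun l => Θ l ω) (firstObs Z n ω) y - cdf (κ x) y =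
        (1 / (k n : ℝ)) * ∑ l ∈ Finset.range (k n),
          (R.treeCdf x y (Θ l ω) (firstObs Z n ω) - cdf (κ x) y) := by
      rw [R.cdfEstimator_eq_average, Finset.sum_sub_distrib, Finset.sum_const, Finset.card_range,
        nsmul_eq_mul, mul_sub, ← mul_assoc, one_div_mul_cancel hk0, one_mul]
    rw [hsplit, Real.norm_eq_abs, abs_mul, abs_of_nonneg (show (0 : ℝ) ≤ 1 / (k n : ℝ) by positivity)]
    gcongr
    exact Finset.abs_sum_le_sum_abs _ _
  filter_upwards [ae_all_iff.2 fun q : ℚ => hpoint q] with ω hω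
  refine tendsto_iSup_abs_sub_of_tendsto_rat (fun n y y' hy => ?_) (fun n y => ?_) (fun n y => ?_)
    (monotone_cdf _) (hyp3 x hx).1 (tendsto_cdf_atBot _) (tendsto_cdf_atTop _) hω
  · simp only [R.cdfEstimator_eq_average]
    gcongr with l _
    exact R.treeCdf_mono x _ _ hy
  · rw [R.cdfEstimator_eq_average]
    exact mul_nonneg (by positivity) (Finset.sum_nonneg fun l _ => R.treeCdf_nonneg x y _ _)
  · have hk0 : (0 : ℝ) < k n := Nat.cast_pos.2 (hk n)
    rw [R.cdfEstimator_eq_average, one_div, inv_mul_le_iff₀ hk0]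
    refine (Finset.sum_le_sum fun l _ => R.treeCdf_le_one x y _ _).trans ?_
    simp
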